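/- Let $r\ge 1$, let $\xi_1,\dots,\xi_r\in\mathbb{C}$ be roots of unity with $\xi_j\neq 1$ for all $j$, and let $\gamma_1,\dots,\gamma_r\in\mathbb{C}$ with $\Re\gamma_j>0$ for all $j$. Consider the multiple zeta-function of generalized Euler–Zagier–Lerch type $$\zeta_r((s_j);(\xi_j);(\gamma_j))=\sum_{m_1=1}^\infty\cdots\sum_{m_r=1}^\infty\ \prod_{j=1}^r \xi_j^{m_j}\,(m_1\gamma_1+\cdots+m_j\gamma_j)^{-s_j},$$ where the complex powers are taken with the principal branch. This series converges absolutely in the region $$\mathcal{D}_r=\{(s_1,\dots,s_r)\in\mathbb{C}^r : \Re(s_{r-k+1}+\cdots+s_r)>k\ \ (1\le k\le r)\},$$ and the function it defines there can be analytically continued to an entire function of $(s_1,\dots,s_r)\in\mathbb{C}^r$. For all integers $n_1,\dots,n_r\ge 0$, the value of this continuation at $(-n_1,\dots,-n_r)$ is $$\zeta_r((-n_j);(\xi_j);(\gamma_j))=(-1)^{r+n_1+\cdots+n_r}\,\mathfrak{B}((n_j);(\xi_j^{-1});(\gamma_j)),$$ where, for roots of unity $\eta_1,\dots,\eta_r\neq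 1$, the twisted multiple Bernoulli numbers $\mathfrak{B}((n_j);(\eta_j);(\gamma_j))$ are defined by the Maclaurin expansion in $t_1,\dots,t_r$ $$\prod_{j=1}^r\frac{1}{1-\eta_j\exp\bigl(\gamma_j\sum_{k=j}^r t_k\bigr)}=\sum_{n_1=0}^\infty\cdots\sum_{n_r=0}^\infty \mathfrak{B}((n_j);(\eta_j);(\gamma_j))\,\frac{t_1^{n_1}}{n_1!}\cdots\frac{t_r^{n_r}}{n_r!}.$$ -/

import Mathlib

noncomputable section

namespace EulerZagierLerch

/-- The term `∏_j ξ_j ^ m_j * (m_1 γ_1 + ⋯ + m_j γ_j) ^ (-s_j)` of the multiple series.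
Complex powers use the principal branch; for `Re γ_k > 0` all bases lie in the right half-plane. -/
def zetaTerm {r : ℕ} (ξ γ s : Fin r → ℂ) (m : Fin r → ℕ+) : ℂ :=
  ∏ j, ξ j ^ (m j : ℕ) * (∑ k ∈ Finset.Iic j, ((m k : ℕ) : ℂ) * γ k) ^ (-s j)

/-- The multiple series `ζ_r((s_j); (ξ_j); (γ_j))`, summed over all `m_1, …, m_r ≥ 1`. -/
def zetaSeries {r : ℕ} (ξ γ s : Fin r → ℂ) : ℂ :=
  ∑' m : Fin r → ℕ+, zetaTerm ξ γ s m

/-- The region `𝒟_r` given by `Re (s_{r-k+1} + ⋯ + s_r) > k` for `1 ≤ k ≤ r`. With indices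
running from `0`, the tail sum starting at `j` has `k = r - j` summands. -/
def convergenceRegion (r : ℕ) : Set (Fin r → ℂ) :=
  {s | ∀ j : Fin r, (r : ℝ) - ((j : ℕ) : ℝ) < (∑ k ∈ Finset.Ici j, s k).re}

/-- `F` is an entire function on `ℂ^r` (holomorphic, that is, complex Fréchet differentiable
everywhere) that agrees with the multiple series on `𝒟_r`. -/
def IsEntireContinuation {r : ℕ} (ξ γ : Fin r → ℂ) (F : (Fin r → ℂ) → ℂ) : Prop :=
  Differentiable ℂ F ∧ ∀ s ∈ convergenceRegion r, F s = zetaSeries ξ γ s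

/-- The Maclaurin expansion of `𝔥(t; ξ) = 1 / (1 - ξ e^t)` for `ξ ≠ 1` (then the constant
coefficient `1 - ξ` of the denominator is nonzero, and this is the true inverse). -/
def twistedGen (ξ : ℂ) : PowerSeries ℂ :=
  (1 - PowerSeries.C ξ * PowerSeries.exp ℂ)⁻¹

/-- The Maclaurin expansion in `t_1, …, t_r` of
`ℌ_r((t_j); (ξ_j); (γ_j)) = ∏_j 𝔥(γ_j (t_j + ⋯ + t_r); ξ_j)`, for `ξ_j ≠ 1`. -/
def twistedMultipleGen {r : ℕ} (ξ γ : Fin r → ℂ) : MvPowerSeries (Fin r) ℂ :=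
  ∏ j, (twistedGen (ξ j)).subst
    (MvPowerSeries.C (γ j) * ∑ k ∈ Finset.Ici j, (MvPowerSeries.X k : MvPowerSeries (Fin r) ℂ))

/-- The twisted multiple Bernoulli number `𝔅((n_j); (ξ_j); (γ_j))`, for `ξ_j ≠ 1`: the coefficient
of `∏_j t_j ^ n_j / n_j!` in `ℌ_r((t_j); (ξ_j); (γ_j))`. -/
def twistedMultipleBernoulli {r : ℕ} (n : Fin r → ℕ) (ξ γ : Fin r → ℂ) : ℂ :=
  (∏ j, ((n j).factorial : ℂ)) *
    MvPowerSeries.coeff (Finsupp.equivFunOnFinite.symm n) (twistedMultipleGen ξ γ)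

end EulerZagierLerch

end

noncomputable section

namespace EulerZagierLerch

open MeasureTheory Set Filter Topology

/-! Put h_j(T) = ξ_j e^{-γ_j T} / (1 - ξ_j e^{-γ_j T}). Since |ξ_j| = 1 and ξ_j ≠ 1, this has no
pole on T ≥ 0, not even at 0, and decays exponentially. Expanding geometric series under the Gamma
integral shows that ∏ Γ(s_j) times the multiple series is the Mellin transform of ∏ h_j(t_j + ⋯ +
t_r), and this integral is holomorphic for all Re s_j > 0.

The continuation uses neither contours nor integration by parts. The series is embedded in a family
indexed by a ∈ ℕ^r: its terms get the weight ∏ binom(m_j - 1, a_j), which on the kernel side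
replaces h_j by h_j^{a_j + 1} (`hasSum_weightedTerm`). Multiplication by m_1 γ_1 + ⋯ + m_j γ_j
lowers s_j by one and maps the family to itself, so each member at s is a finite combination of
members at s + e_j (`normalizedMellin_recurrence`). Iterating this reaches all of ℂ^r
(`exists_entire_continuation`).

The values at (-n_j) come from the same recurrence. At the origin the value is ∏ h_j(0)^{a_j + 1},
because t^{ε-1} dt / Γ(ε) concentrates at 0 as ε → 0+ (`tendsto_normalizedMellin`). On the formal
side, h' = -(h + h²) for h = 1/(ξ⁻¹ e^t - 1) gives the partial derivatives of the kernel's Maclaurin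
series the same recurrence up to sign (`pderiv_multiKernelSeries`). Induction on ∑ n_j identifies
the two (`entire_value_neg_nat`), and a = 0 is the theorem.

On 𝒟_r, Abel summation gives locally uniform absolute convergence (`exists_summable_bound`), and the
identity theorem carries the equality from large Re s_j to all of 𝒟_r. -/

/-! ### Product series, Abel summation and identity theorems. -/

/-- A product of finitely many absolutely convergent series is the sum over all multi-indices. -/
theorem hasSum_pi_prod {ι : Type*} {r : ℕ} (f : Fin r → ι → ℂ)
    (hf : ∀ j, Summable fun i => ‖f j i‖) :
    Summable (fun m : Fin r → ι => ‖∏ j, f j (m j)‖) ∧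
      HasSum (fun m : Fin r → ι => ∏ j, f j (m j)) (∏ j, ∑' i, f j i) := by
  induction r with
  | zero =>
    refine ⟨(hasSum_fintype _).summable, ?_⟩
    simp
  | succ r ih =>
    obtain ⟨h1, h2⟩ := ih (fun j => f j.succ) (fun j => hf j.succ)
    let e : ι × (Fin r → ι) ≃ (Fin (r + 1) → ι) := Fin.consEquiv (fun _ => ι)
    have he : ∀ p : ι × (Fin r → ι), ∏ j, f j (e p j) = f 0 p.1 * ∏ j : Fin r, f j.succ (p.2 j) := by
      intro p
      rw [Fin.prod_univ_succ]
      rfl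
    have hn : Summable fun p : ι × (Fin r → ι) => ‖f 0 p.1 * ∏ j : Fin r, f j.succ (p.2 j)‖ :=
      ((hf 0).mul_of_nonneg h1 (fun _ => norm_nonneg _) (fun _ => norm_nonneg _)).congr
        fun p => (norm_mul _ _).symm
    constructor
    · rw [← e.summable_iff]
      exact hn.congr fun p => by rw [Function.comp_apply, he]
    · rw [← e.hasSum_iff, Fin.prod_univ_succ]
      have hm := (hf 0).of_norm.hasSum.mul h2 hn.of_norm
      exact hm.congr_fun fun p => he p

theorem summable_pi_prod_real {ι : Type*} {r : ℕ} (f : Fin r → ι → ℝ)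
    (hf : ∀ j, Summable (f j)) (h0 : ∀ j i, 0 ≤ f j i) :
    Summable (fun m : Fin r → ι => ∏ j, f j (m j)) := by
  have := (hasSum_pi_prod (fun j i => (f j i : ℂ)) (fun j => by
    simpa [abs_of_nonneg, h0] using hf j)).1
  refine this.congr fun m => ?_
  rw [← Complex.ofReal_prod, Complex.norm_real, Real.norm_of_nonneg]
  exact Finset.prod_nonneg fun j _ => h0 _ _

/-- Abel summation: a weighted sum of a nonnegative increasing sequence is nonnegative when all
tail sums of the weights are. -/
theorem sum_mul_nonneg_of_tail_nonneg {r : ℕ} (d L : Fin r → ℝ) (hL : Monotone L)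
    (hL0 : ∀ j, 0 ≤ L j) (hd : ∀ j, 0 ≤ ∑ k ∈ Finset.Ici j, d k) : 0 ≤ ∑ j, d j * L j := by
  induction r with
  | zero => simp
  | succ r ih =>
    -- The induction rests on ∑ d_j L_j = L_0 ∑ d_j + ∑_{j ≥ 1} d_j (L_j - L_0).
    have h := ih (fun j => d j.succ) (fun j => L j.succ - L 0)
      (fun i j hij => by
        have := hL (Fin.succ_le_succ_iff.2 hij)
        simpa using this)
      (fun j => sub_nonneg.2 (hL (Fin.zero_le _)))
      (fun j => by
        have := hd j.succ
        rwa [← Fin.map_succEmb_Ici, Finset.sum_map] at this)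
    have h0 := hd 0
    rw [show Finset.Ici (0 : Fin (r + 1)) = Finset.univ by ext; simp, Fin.sum_univ_succ] at h0
    rw [Fin.sum_univ_succ]
    have h3 := mul_nonneg h0 (hL0 0)
    simp only [mul_sub, Finset.sum_sub_distrib, ← Finset.sum_mul] at h
    linarith

/-- Identity theorem on convex open sets for functions that are holomorphic along complex lines. -/
theorem eqOn_of_holomorphic_on_lines {E : Type*} [NormedAddCommGroup E] [NormedSpace ℂ E]
    {U : Set E} (hU : IsOpen U) (hc : Convex ℝ U) {f g : E → ℂ}
    (hf : ∀ x y, DifferentiableOn ℂ (fun z : ℂ => f (x + z • y)) {z | x + z • y ∈ U})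
    (hg : ∀ x y, DifferentiableOn ℂ (fun z : ℂ => g (x + z • y)) {z | x + z • y ∈ U})
    {x : E} (hx : x ∈ U) (hfg : f =ᶠ[𝓝 x] g) : EqOn f g U := by
  intro y hy
  -- The complex line through x (at z = 0) and y (at z = 1) meets U in a convex, hence connected,
  -- set of parameters, so one-variable uniqueness applies.
  have hcont : Continuous fun z : ℂ => x + z • (y - x) := by fun_prop
  have ho : IsOpen {z : ℂ | x + z • (y - x) ∈ U} := hU.preimage hcont
  have hconv : Convex ℝ {z : ℂ | x + z • (y - x) ∈ U} := by
    intro z hz w hw a b ha hb hab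
    have := hc hz hw ha hb hab
    simp only [mem_ofPred_eq] at this ⊢
    convert this using 1
    rw [smul_add, smul_add, add_add_add_comm, ← add_smul, hab, one_smul, add_smul, smul_assoc,
      smul_assoc]
  have h := AnalyticOnNhd.eqOn_of_preconnected_of_eventuallyEq
    ((hf x (y - x)).analyticOnNhd ho) ((hg x (y - x)).analyticOnNhd ho) hconv.isPreconnected
    (z₀ := 0) (by simpa using hx)
    (by
      have h2 : Tendsto (fun z : ℂ => x + z • (y - x)) (𝓝 0) (𝓝 x) := by
        simpa using hcont.tendsto 0
      exact h2.eventually hfg)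
  simpa using h (show (1 : ℂ) ∈ {z : ℂ | x + z • (y - x) ∈ U} by simpa using hy)

/-- Identity theorem on convex open sets for holomorphic functions. -/
theorem eqOn_of_differentiableOn {E : Type*} [NormedAddCommGroup E] [NormedSpace ℂ E]
    {U : Set E} (hU : IsOpen U) (hc : Convex ℝ U) {f g : E → ℂ}
    (hf : DifferentiableOn ℂ f U) (hg : DifferentiableOn ℂ g U)
    {x : E} (hx : x ∈ U) (hfg : f =ᶠ[𝓝 x] g) : EqOn f g U := by
  have key : ∀ {f : E → ℂ}, DifferentiableOn ℂ f U → ∀ x y,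
      DifferentiableOn ℂ (fun z : ℂ => f (x + z • y)) {z | x + z • y ∈ U} := by
    intro f hf x y
    exact hf.comp (by fun_prop) (fun z hz => hz)
  exact eqOn_of_holomorphic_on_lines hU hc (key hf) (key hg) hx hfg

/-! ### The Gamma integral in the right half-plane. -/

theorem integrableOn_rpow_mul_exp {σ c : ℝ} (hσ : 0 < σ) (hc : 0 < c) :
    IntegrableOn (fun t : ℝ => t ^ (σ - 1) * Real.exp (-(c * t))) (Ioi 0) := by
  have := integrableOn_rpow_mul_exp_neg_mul_rpow (s := σ - 1) (p := 1) (b := c)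
    (by linarith) one_pos hc
  simpa [neg_mul] using this

theorem norm_cpow_mul_cexp {t : ℝ} (ht : 0 < t) (s z : ℂ) :
    ‖(t : ℂ) ^ (s - 1) * Complex.exp (-(z * t))‖ = t ^ (s.re - 1) * Real.exp (-(z.re * t)) := by
  rw [norm_mul, Complex.norm_cpow_eq_rpow_re_of_pos ht, Complex.norm_exp]
  simp

theorem integrableOn_cpow_mul_cexp {s z : ℂ} (hs : 0 < s.re) (hz : 0 < z.re) :
    IntegrableOn (fun t : ℝ => (t : ℂ) ^ (s - 1) * Complex.exp (-(z * t))) (Ioi 0) := by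
  refine (integrableOn_rpow_mul_exp hs hz).mono' ?_ ?_
  · refine ContinuousOn.aestronglyMeasurable (fun t ht =>
      ContinuousAt.continuousWithinAt ?_) measurableSet_Ioi
    have : ContinuousAt (fun t : ℝ => (t : ℂ) ^ (s - 1)) t :=
      (Complex.continuous_ofReal.continuousAt).cpow continuousAt_const (Or.inl (by simpa using ht))
    exact this.mul (by fun_prop)
  · filter_upwards [ae_restrict_mem measurableSet_Ioi] with t ht
    exact (norm_cpow_mul_cexp ht s z).le

/-- The Gamma integral `∫ t ^ (s - 1) e ^ (-z t) = Γ(s) z ^ (-s)` for complex `z` in the right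
half-plane. -/
theorem integral_cpow_mul_cexp {s z : ℂ} (hs : 0 < s.re) (hz : 0 < z.re) :
    ∫ t : ℝ in Ioi 0, (t : ℂ) ^ (s - 1) * Complex.exp (-(z * t)) =
      z ^ (-s) * Complex.Gamma s := by
  have ho : IsOpen {z : ℂ | 0 < z.re} := isOpen_lt continuous_const Complex.continuous_re
  have hcv : Convex ℝ {z : ℂ | 0 < z.re} := convex_halfSpace_re_gt 0
  have hd : DifferentiableOn ℂ (fun z : ℂ => ∫ t : ℝ in Ioi 0,
      (t : ℂ) ^ (s - 1) * Complex.exp (-(z * t))) {z : ℂ | 0 < z.re} := by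
    intro w hw
    refine DifferentiableAt.differentiableWithinAt ?_
    have hw' : 0 < w.re := hw
    have hnb : {z : ℂ | w.re / 2 < z.re} ∈ 𝓝 w :=
      (isOpen_lt continuous_const Complex.continuous_re).mem_nhds (by simp; linarith)
    refine (hasDerivAt_integral_of_dominated_loc_of_deriv_le (𝕜 := ℂ)
      (F' := fun z t => (t : ℂ) ^ (s - 1) * (Complex.exp (-(z * t)) * (-t)))
      -- Halving Re w makes the exponential bound uniform near w; the factor t from differentiation
      -- raises the exponent from Re s to Re s + 1.
      (bound := fun t => t ^ ((s.re + 1) - 1) * Real.exp (-((w.re / 2) * t)))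
      hnb ?_ ?_ ?_ ?_ ?_ ?_).2.differentiableAt
    · filter_upwards [ho.mem_nhds hw] with y hy
      exact (integrableOn_cpow_mul_cexp hs hy).aestronglyMeasurable
    · exact integrableOn_cpow_mul_cexp hs hw
    · have := (integrableOn_cpow_mul_cexp hs hw).aestronglyMeasurable.mul
        (Continuous.aestronglyMeasurable (f := fun t : ℝ => -(t : ℂ)) (by fun_prop))
      refine this.congr (ae_of_all _ fun t => ?_)
      simp [mul_assoc]
    · filter_upwards [ae_restrict_mem measurableSet_Ioi] with t ht y hy
      have ht' : 0 < t := ht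
      rw [← mul_assoc, norm_mul, norm_cpow_mul_cexp ht', norm_neg, Complex.norm_real,
        Real.norm_of_nonneg ht'.le, mul_right_comm, ← Real.rpow_add_one ht'.ne']
      rw [show s.re - 1 + 1 = s.re + 1 - 1 by ring]
      have hy' : w.re / 2 < y.re := hy
      gcongr
    · exact integrableOn_rpow_mul_exp (by linarith) (by linarith)
    · refine ae_of_all _ fun t y hy => ?_
      have h1 : HasDerivAt (fun z : ℂ => -(z * (t : ℂ))) (-(t : ℂ)) y := by
        have := ((hasDerivAt_id y).mul_const (t : ℂ)).neg
        rwa [one_mul] at this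
      exact h1.cexp.const_mul _
  have hg : DifferentiableOn ℂ (fun z : ℂ => z ^ (-s) * Complex.Gamma s) {z : ℂ | 0 < z.re} := by
    intro w hw
    refine DifferentiableAt.differentiableWithinAt ?_
    exact (differentiableAt_id.cpow (differentiableAt_const _) (Or.inl hw)).mul_const _
  refine AnalyticOnNhd.eqOn_of_preconnected_of_frequently_eq (hd.analyticOnNhd ho)
    (hg.analyticOnNhd ho) hcv.isPreconnected (z₀ := 1) (by simp) ?_ hz
  have hreal : ∀ x : ℝ, 0 < x → (∫ t : ℝ in Ioi 0, (t : ℂ) ^ (s - 1) *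
      Complex.exp (-((x : ℂ) * t))) = (x : ℂ) ^ (-s) * Complex.Gamma s := by
    intro x hx
    rw [Complex.integral_cpow_mul_exp_neg_mul_Ioi hs hx, one_div, Complex.inv_cpow,
      Complex.cpow_neg]
    rw [Complex.arg_ofReal_of_nonneg hx.le]
    exact Real.pi_pos.ne
  -- The formula is known for positive real z, and these accumulate at 1, which is enough for the
  -- identity theorem.
  have ht : Tendsto (fun x : ℝ => (x : ℂ)) (𝓝[>] 1) (𝓝[≠] 1) := by
    refine tendsto_nhdsWithin_iff.2 ⟨?_, ?_⟩
    · exact (Complex.continuous_ofReal.tendsto' 1 1 (by simp)).mono_left nhdsWithin_le_nhds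
    · filter_upwards [self_mem_nhdsWithin] with x hx
      simpa using (ne_of_gt hx : x ≠ 1)
  refine ht.frequently (Eventually.frequently ?_)
  filter_upwards [self_mem_nhdsWithin] with x hx
  exact hreal x (lt_trans one_pos hx)

/-! ### The kernel on the orthant and its exponential bounds. -/

/-- Lebesgue measure on the open positive orthant of `ℝ^r`. -/
def orthantMeasure (r : ℕ) : Measure (Fin r → ℝ) :=
  Measure.pi fun _ => volume.restrict (Ioi 0)

theorem ae_orthantMeasure_pos (r : ℕ) : ∀ᵐ t ∂orthantMeasure r, ∀ j, 0 < t j :=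
  ae_all_iff.2 fun j =>
    (Measure.tendsto_eval_ae_ae (μ := fun _ : Fin r => volume.restrict (Ioi (0 : ℝ)))
      (i := j)).eventually (ae_restrict_mem measurableSet_Ioi)

/-- The function `ξ e^{-γ T} / (1 - ξ e^{-γ T}) = ∑_{m ≥ 1} ξ^m e^{-m γ T}`. -/
def geomKernel (ξ γ : ℂ) (T : ℝ) : ℂ :=
  ξ * Complex.exp (-(γ * T)) / (1 - ξ * Complex.exp (-(γ * T)))

theorem norm_mul_cexp_eq {ξ : ℂ} (hξ : ‖ξ‖ = 1) (γ : ℂ) (T : ℝ) :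
    ‖ξ * Complex.exp (-(γ * T))‖ = Real.exp (-(γ.re * T)) := by
  rw [norm_mul, hξ, one_mul, Complex.norm_exp]
  simp

theorem one_sub_mul_cexp_ne_zero {ξ γ : ℂ} (hξ : ‖ξ‖ = 1) (hξ1 : ξ ≠ 1) (hγ : 0 < γ.re) {T : ℝ}
    (hT : 0 ≤ T) : 1 - ξ * Complex.exp (-(γ * T)) ≠ 0 := by
  intro h
  have h1 : ξ * Complex.exp (-(γ * T)) = 1 := (sub_eq_zero.1 h).symm
  have h2 := norm_mul_cexp_eq hξ γ T
  rw [h1, norm_one, eq_comm, Real.exp_eq_one_iff] at h2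
  have h3 : T = 0 := by
    rcases mul_eq_zero.1 (neg_eq_zero.1 h2) with h | h
    · exact absurd h hγ.ne'
    · exact h
  subst h3
  exact hξ1 (by simpa using h1)

/-- The denominator tends to 1 at infinity and is continuous without zeros on compact intervals of
[0, ∞), so its inverse is bounded. -/
theorem exists_norm_geomKernel_le {ξ γ : ℂ} (hξ : ‖ξ‖ = 1) (hξ1 : ξ ≠ 1) (hγ : 0 < γ.re) :
    ∃ C, 0 < C ∧ ∀ T : ℝ, 0 ≤ T → ‖geomKernel ξ γ T‖ ≤ C * Real.exp (-(γ.re * T)) := by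
  have hlim : Tendsto (fun T : ℝ => (1 - ξ * Complex.exp (-(γ * T)))⁻¹) atTop (𝓝 1) := by
    have h0 : Tendsto (fun T : ℝ => ξ * Complex.exp (-(γ * T))) atTop (𝓝 0) := by
      rw [tendsto_zero_iff_norm_tendsto_zero]
      simp_rw [norm_mul_cexp_eq hξ]
      exact Real.tendsto_exp_neg_atTop_nhds_zero.comp (tendsto_id.const_mul_atTop hγ)
    simpa using (tendsto_const_nhds.sub h0).inv₀ (by simp : (1 : ℂ) - 0 ≠ 0)
  have hev : ∀ᶠ T : ℝ in atTop, ‖(1 - ξ * Complex.exp (-(γ * T)))⁻¹‖ ≤ 2 :=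
    hlim.norm.eventually_le_const (by simp)
  obtain ⟨T₀, hT₀⟩ := eventually_atTop.1 hev
  obtain ⟨C, hC⟩ := (isCompact_Icc (a := (0 : ℝ)) (b := T₀)).exists_bound_of_continuousOn
    (f := fun T : ℝ => (1 - ξ * Complex.exp (-(γ * T)))⁻¹)
    (ContinuousOn.inv₀ (by fun_prop) fun T hT => one_sub_mul_cexp_ne_zero hξ hξ1 hγ hT.1)
  refine ⟨max C 2, by positivity, fun T hT => ?_⟩
  rw [geomKernel, div_eq_mul_inv, norm_mul, norm_mul_cexp_eq hξ, mul_comm]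
  gcongr
  rcases le_total T T₀ with h | h
  · exact (hC T ⟨hT, h⟩).trans (le_max_left _ _)
  · exact (hT₀ T h).trans (le_max_right _ _)

/-- The function `∏_j h_j(t_j + ⋯ + t_r) ^ (a_j + 1)` with `h_j = geomKernel ξ_j γ_j`. -/
def multiKernel {r : ℕ} (ξ γ : Fin r → ℂ) (a : Fin r → ℕ) (t : Fin r → ℝ) : ℂ :=
  ∏ j, geomKernel (ξ j) (γ j) (∑ k ∈ Finset.Ici j, t k) ^ (a j + 1)

theorem measurable_multiKernel {r : ℕ} (ξ γ : Fin r → ℂ) (a : Fin r → ℕ) :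
    Measurable (multiKernel ξ γ a) := by
  unfold multiKernel geomKernel
  fun_prop

/-- Each tail sum dominates its first entry t_j, so the bound factorises over the coordinates. -/
theorem exists_norm_multiKernel_le {r : ℕ} {ξ γ : Fin r → ℂ} (hξ : ∀ j, ‖ξ j‖ = 1)
    (hξ1 : ∀ j, ξ j ≠ 1) (hγ : ∀ j, 0 < (γ j).re) (a : Fin r → ℕ) :
    ∃ C, 0 < C ∧ ∀ t : Fin r → ℝ, (∀ j, 0 ≤ t j) →
      ‖multiKernel ξ γ a t‖ ≤ C * ∏ j, Real.exp (-((γ j).re * t j)) := by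
  choose C hC hb using fun j => exists_norm_geomKernel_le (hξ j) (hξ1 j) (hγ j)
  refine ⟨∏ j, C j ^ (a j + 1), Finset.prod_pos fun j _ => pow_pos (hC j) _, fun t ht => ?_⟩
  rw [multiKernel, norm_prod, ← Finset.prod_mul_distrib]
  refine Finset.prod_le_prod (fun _ _ => norm_nonneg _) fun j _ => ?_
  have h1 : t j ≤ ∑ k ∈ Finset.Ici j, t k :=
    Finset.single_le_sum (f := t) (fun k _ => ht k) (Finset.mem_Ici.2 le_rfl)
  have hγ' := hγ j
  have h2 : Real.exp (-((γ j).re * ∑ k ∈ Finset.Ici j, t k)) ≤ Real.exp (-((γ j).re * t j)) := by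
    gcongr
  have h4 : Real.exp (-((γ j).re * t j)) ≤ 1 := by
    rw [Real.exp_le_one_iff]
    have := mul_nonneg hγ'.le (ht j)
    linarith
  calc ‖geomKernel (ξ j) (γ j) (∑ k ∈ Finset.Ici j, t k) ^ (a j + 1)‖
      ≤ (C j * Real.exp (-((γ j).re * t j))) ^ (a j + 1) := by
        rw [norm_pow]
        refine pow_le_pow_left₀ (norm_nonneg _) ((hb j _ ((ht j).trans h1)).trans ?_) _
        exact mul_le_mul_of_nonneg_left h2 (hC j).le
    _ = C j ^ (a j + 1) * (Real.exp (-((γ j).re * t j)) ^ a j * Real.exp (-((γ j).re * t j))) := by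
        rw [mul_pow, pow_succ (Real.exp _)]
    _ ≤ C j ^ (a j + 1) * (1 * Real.exp (-((γ j).re * t j))) := by
        have := hC j
        gcongr
        exact pow_le_one₀ (Real.exp_pos _).le h4
    _ = _ := by rw [one_mul]

/-! ### Holomorphy of the Mellin transform. -/

/-- The Mellin transform of `multiKernel`, without Gamma factors. -/
def mellinIntegral {r : ℕ} (ξ γ : Fin r → ℂ) (a : Fin r → ℕ) (s : Fin r → ℂ) : ℂ :=
  ∫ t, (∏ j, (t j : ℂ) ^ (s j - 1)) * multiKernel ξ γ a t ∂orthantMeasure r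

theorem norm_prod_cpow {r : ℕ} {t : Fin r → ℝ} (ht : ∀ j, 0 < t j) (s : Fin r → ℂ) :
    ‖∏ j, (t j : ℂ) ^ (s j - 1)‖ = ∏ j, t j ^ ((s j).re - 1) := by
  rw [norm_prod]
  refine Finset.prod_congr rfl fun j _ => ?_
  rw [Complex.norm_cpow_eq_rpow_re_of_pos (ht j)]
  simp

theorem integrable_prod_rpow_mul_exp {r : ℕ} {σ c : Fin r → ℝ} (hσ : ∀ j, 0 < σ j)
    (hc : ∀ j, 0 < c j) :
    Integrable (fun t : Fin r → ℝ => ∏ j, t j ^ (σ j - 1) * Real.exp (-(c j * t j)))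
      (orthantMeasure r) :=
  Integrable.fintype_prod (f := fun j (x : ℝ) => x ^ (σ j - 1) * Real.exp (-(c j * x)))
    fun j => integrableOn_rpow_mul_exp (hσ j) (hc j)

theorem integrable_mellin {r : ℕ} {ξ γ : Fin r → ℂ} (hξ : ∀ j, ‖ξ j‖ = 1)
    (hξ1 : ∀ j, ξ j ≠ 1) (hγ : ∀ j, 0 < (γ j).re) (a : Fin r → ℕ) {s : Fin r → ℂ}
    (hs : ∀ j, 0 < (s j).re) :
    Integrable (fun t : Fin r → ℝ => (∏ j, (t j : ℂ) ^ (s j - 1)) * multiKernel ξ γ a t)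
      (orthantMeasure r) := by
  obtain ⟨C, hC, hb⟩ := exists_norm_multiKernel_le hξ hξ1 hγ a
  refine ((integrable_prod_rpow_mul_exp hs hγ).const_mul C).mono' ?_ ?_
  · have := measurable_multiKernel ξ γ a
    exact Measurable.aestronglyMeasurable (by fun_prop)
  · filter_upwards [ae_orthantMeasure_pos r] with t ht
    rw [norm_mul, norm_prod_cpow ht, Finset.prod_mul_distrib, mul_left_comm]
    gcongr
    · exact Finset.prod_nonneg fun j _ => Real.rpow_nonneg (ht j).le _
    · exact hb t fun j => (ht j).le

theorem abs_log_le_rpow_add {t δ : ℝ} (ht : 0 < t) (hδ : 0 < δ) :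
    1 + |Real.log t| ≤ (1 + 1 / δ) * (t ^ δ + t ^ (-δ)) := by
  have hp : 0 < t ^ δ := Real.rpow_pos_of_pos ht _
  have hn : 0 < t ^ (-δ) := Real.rpow_pos_of_pos ht _
  have h1 : Real.log t ≤ t ^ δ / δ := Real.log_le_rpow_div ht.le hδ
  have h2 : -Real.log t ≤ t ^ (-δ) / δ := by
    rw [← Real.log_inv, Real.rpow_neg ht.le, ← Real.inv_rpow ht.le]
    exact Real.log_le_rpow_div (inv_pos.2 ht).le hδ
  have h3 : 1 ≤ t ^ δ + t ^ (-δ) := by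
    rcases le_total 1 t with h | h
    · linarith [Real.one_le_rpow h hδ.le]
    · linarith [Real.one_le_rpow_of_pos_of_le_one_of_nonpos ht h (neg_nonpos.2 hδ.le)]
  have h4 : |Real.log t| ≤ (t ^ δ + t ^ (-δ)) / δ := by
    have : (t ^ δ + t ^ (-δ)) / δ = t ^ δ / δ + t ^ (-δ) / δ := add_div _ _ _
    have := div_pos hp hδ
    have := div_pos hn hδ
    rw [abs_le]
    constructor <;> linarith
  calc 1 + |Real.log t| ≤ (t ^ δ + t ^ (-δ)) + (t ^ δ + t ^ (-δ)) / δ := add_le_add h3 h4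
    _ = _ := by ring

theorem rpow_le_rpow_mul_add {t σ σ₀ δ : ℝ} (ht : 0 < t) (h : |σ - σ₀| ≤ δ) :
    t ^ (σ - 1) ≤ t ^ (σ₀ - 1) * (t ^ δ + t ^ (-δ)) := by
  have hp : 0 < t ^ δ := Real.rpow_pos_of_pos ht _
  have hn : 0 < t ^ (-δ) := Real.rpow_pos_of_pos ht _
  rw [show σ - 1 = (σ₀ - 1) + (σ - σ₀) by ring, Real.rpow_add ht]
  have := abs_le.1 h
  gcongr
  rcases le_total 1 t with h | h
  · linarith [Real.rpow_le_rpow_of_exponent_le h this.2]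
  · linarith [Real.rpow_le_rpow_of_exponent_ge ht h this.1]

/-- Turns the sum of logarithms produced by differentiation into a product, so that the majorant
factorises over the coordinates. -/
theorem sum_le_prod_one_add {ι : Type*} (s : Finset ι) (f : ι → ℝ) (hf : ∀ i, 0 ≤ f i) :
    1 + ∑ i ∈ s, f i ≤ ∏ i ∈ s, (1 + f i) := by
  classical
  induction s using Finset.induction_on with
  | empty => simp
  | insert i s hi ih =>
    rw [Finset.sum_insert hi, Finset.prod_insert hi]
    have h1 : 0 ≤ ∑ i ∈ s, f i := Finset.sum_nonneg fun i _ => hf i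
    nlinarith [mul_le_mul_of_nonneg_left ih (hf i), mul_nonneg (hf i) h1]

theorem differentiableAt_mellinIntegral {r : ℕ} {ξ γ : Fin r → ℂ} (hξ : ∀ j, ‖ξ j‖ = 1)
    (hξ1 : ∀ j, ξ j ≠ 1) (hγ : ∀ j, 0 < (γ j).re) (a : Fin r → ℕ) {s₀ : Fin r → ℂ}
    (hs₀ : ∀ j, 0 < (s₀ j).re) : DifferentiableAt ℂ (mellinIntegral ξ γ a) s₀ := by
  obtain ⟨C, hC, hb⟩ := exists_norm_multiKernel_le hξ hξ1 hγ a
  obtain ⟨ε, hε, hεs⟩ := Pi.exists_forall_pos_add_lt hs₀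
  simp only [zero_add] at hεs
  -- One δ pays for moving s within the ball, the other for the logarithm; hence the square of t^δ +
  -- t^{-δ} in `B`.
  obtain ⟨δ, hδ, rfl⟩ : ∃ δ, 0 < δ ∧ ε = 2 * δ := ⟨ε / 2, by positivity, by ring⟩
  let B : Fin r → ℝ → ℝ := fun j t => (1 + 1 / δ) *
    (t ^ ((s₀ j).re - 1) * (t ^ δ + t ^ (-δ)) ^ 2 * Real.exp (-((γ j).re * t)))
  have hB : ∀ j, IntegrableOn (B j) (Ioi 0) := by
    intro j
    have h1 := integrableOn_rpow_mul_exp (σ := (s₀ j).re + 2 * δ) (by linarith [hs₀ j]) (hγ j)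
    have h2 := integrableOn_rpow_mul_exp (σ := (s₀ j).re) (hs₀ j) (hγ j)
    have h3 := integrableOn_rpow_mul_exp (σ := (s₀ j).re - 2 * δ) (by linarith [hεs j]) (hγ j)
    refine Integrable.const_mul ?_ _
    refine ((h1.add (h2.const_mul 2)).add h3).congr ?_
    filter_upwards [ae_restrict_mem measurableSet_Ioi] with t ht
    have ht' : 0 < t := ht
    have e1 : t ^ ((s₀ j).re + 2 * δ - 1) = t ^ ((s₀ j).re - 1) * (t ^ δ) ^ 2 := by
      rw [← Real.rpow_natCast, ← Real.rpow_mul ht'.le, ← Real.rpow_add ht']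
      congr 1; push_cast; ring
    have e2 : t ^ ((s₀ j).re - 2 * δ - 1) = t ^ ((s₀ j).re - 1) * (t ^ (-δ)) ^ 2 := by
      rw [← Real.rpow_natCast, ← Real.rpow_mul ht'.le, ← Real.rpow_add ht']
      congr 1; push_cast; ring
    have e3 : t ^ δ * t ^ (-δ) = 1 := by rw [← Real.rpow_add ht']; simp
    simp only [Pi.add_apply]
    rw [e1, e2]
    linear_combination (-2 * t ^ ((s₀ j).re - 1) * Real.exp (-((γ j).re * t))) * e3
  have hk := measurable_multiKernel ξ γ a
  refine (hasFDerivAt_integral_of_dominated_of_fderiv_le (𝕜 := ℂ)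
    (F' := fun s t => ((∏ j, (t j : ℂ) ^ (s j - 1)) * multiKernel ξ γ a t) •
      ∑ j, (Real.log (t j) : ℂ) • ContinuousLinearMap.proj (R := ℂ) (φ := fun _ : Fin r => ℂ) j)
    (bound := fun t => C * ∏ j, B j (t j))
    (Metric.ball_mem_nhds s₀ hδ) ?_ ?_ ?_ ?_ ?_ ?_).differentiableAt
  · exact Eventually.of_forall fun s => Measurable.aestronglyMeasurable (by fun_prop)
  · exact integrable_mellin hξ hξ1 hγ a hs₀
  · refine AEStronglyMeasurable.smul
      (f := fun t : Fin r → ℝ => (∏ j, (t j : ℂ) ^ (s₀ j - 1)) * multiKernel ξ γ a t)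
      (Measurable.aestronglyMeasurable (by fun_prop)) ?_
    refine Finset.aestronglyMeasurable_fun_sum _ fun j _ => ?_
    refine AEStronglyMeasurable.smul_const (Measurable.aestronglyMeasurable ?_) _
    exact Complex.measurable_ofReal.comp (Real.measurable_log.comp (measurable_pi_apply j))
  · filter_upwards [ae_orthantMeasure_pos r] with t ht s hs
    have hlin : ‖∑ j, (Real.log (t j) : ℂ) •
        ContinuousLinearMap.proj (R := ℂ) (φ := fun _ : Fin r => ℂ) j‖ ≤
          ∏ j, (1 + |Real.log (t j)|) := by
      refine (norm_sum_le _ _).trans (le_trans (Finset.sum_le_sum (g := fun j => |Real.log (t j)|)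
        fun j _ => ?_) (le_trans (by linarith) (sum_le_prod_one_add _ _ fun j => abs_nonneg _)))
      rw [norm_smul, Complex.norm_real, Real.norm_eq_abs]
      refine mul_le_of_le_one_right (abs_nonneg _) ?_
      exact ContinuousLinearMap.opNorm_le_bound _ zero_le_one fun v => by
        simpa using norm_le_pi_norm v j
    rw [norm_smul, norm_mul, norm_prod_cpow ht]
    have hP : 0 ≤ ∏ j, t j ^ ((s j).re - 1) :=
      Finset.prod_nonneg fun j _ => Real.rpow_nonneg (ht j).le _
    calc _ ≤ (∏ j, t j ^ ((s j).re - 1)) * (C * ∏ j, Real.exp (-((γ j).re * t j))) *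
          ∏ j, (1 + |Real.log (t j)|) := by
          gcongr
          exact hb t fun j => (ht j).le
      _ = C * ∏ j, (t j ^ ((s j).re - 1) * Real.exp (-((γ j).re * t j)) *
            (1 + |Real.log (t j)|)) := by
          rw [Finset.prod_mul_distrib, Finset.prod_mul_distrib]; ring
      _ ≤ C * ∏ j, B j (t j) := by
          refine mul_le_mul_of_nonneg_left (Finset.prod_le_prod (fun j _ => ?_) fun j _ => ?_) hC.le
          · have := Real.rpow_nonneg (ht j).le ((s j).re - 1)
            positivity
          · have h1 := abs_log_le_rpow_add (ht j) hδ
            have h2 : |(s j).re - (s₀ j).re| ≤ δ := by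
              rw [← Complex.sub_re]
              refine (Complex.abs_re_le_norm _).trans ?_
              have := norm_le_pi_norm (s - s₀) j
              rw [Pi.sub_apply] at this
              exact this.trans (mem_ball_iff_norm.1 hs).le
            have h3 := rpow_le_rpow_mul_add (ht j) h2
            have hp := Real.rpow_nonneg (ht j).le δ
            have hn := Real.rpow_nonneg (ht j).le (-δ)
            have hp0 := Real.rpow_nonneg (ht j).le ((s₀ j).re - 1)
            calc _ ≤ t j ^ ((s₀ j).re - 1) * (t j ^ δ + t j ^ (-δ)) *
                  Real.exp (-((γ j).re * t j)) * ((1 + 1 / δ) * (t j ^ δ + t j ^ (-δ))) := by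
                    gcongr
              _ = B j (t j) := by simp only [B]; ring
  · exact (Integrable.fintype_prod (f := B) hB).const_mul C
  · filter_upwards [ae_orthantMeasure_pos r] with t ht s hs
    have hexp : (fun s : Fin r → ℂ => (∏ j, (t j : ℂ) ^ (s j - 1)) * multiKernel ξ γ a t) =
        fun s => Complex.exp (∑ j, (s j - 1) * (Real.log (t j) : ℂ)) * multiKernel ξ γ a t := by
      funext s
      rw [Complex.exp_sum]
      congr 1
      refine Finset.prod_congr rfl fun j _ => ?_
      rw [Complex.cpow_def_of_ne_zero (by exact_mod_cast (ht j).ne'), ← Complex.ofReal_log (ht j).le,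
        mul_comm]
    rw [hexp, congrFun hexp s]
    have h1 : HasFDerivAt (fun s : Fin r → ℂ => ∑ j, (s j - 1) * (Real.log (t j) : ℂ))
        (∑ j, (Real.log (t j) : ℂ) •
          ContinuousLinearMap.proj (R := ℂ) (φ := fun _ : Fin r => ℂ) j) s := by
      refine HasFDerivAt.fun_sum fun j _ => ?_
      exact ((hasFDerivAt_apply j s).sub_const 1).mul_const _
    have h2 := h1.cexp.mul_const (multiKernel ξ γ a t)
    exact h2.congr_fderiv (by rw [smul_smul, mul_comm])

/-! ### The weighted series as a Mellin transform. -/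

theorem hasSum_choose_mul_pow {x : ℂ} (hx : ‖x‖ < 1) (a : ℕ) :
    HasSum (fun m : ℕ+ => (((m : ℕ) - 1).choose a : ℂ) * x ^ (m : ℕ)) ((x / (1 - x)) ^ (a + 1)) := by
  have h1 : HasSum (fun n : ℕ => ((n + a).choose a : ℂ) * x ^ (n + a + 1))
      ((x / (1 - x)) ^ (a + 1)) := by
    have := (hasSum_choose_mul_geometric_of_norm_lt_one a hx).mul_right (x ^ (a + 1))
    rw [div_pow, div_eq_mul_one_div, mul_comm (x ^ (a + 1))]
    refine this.congr_fun fun n => ?_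
    ring
  have h2 : HasSum (fun n : ℕ => (n.choose a : ℂ) * x ^ (n + 1)) ((x / (1 - x)) ^ (a + 1)) := by
    -- The indices missed by n ↦ n + a are those below a, where the binomial coefficient vanishes.
    refine ((add_left_injective a).hasSum_iff fun n hn => ?_).1 h1
    have : n < a := by
      by_contra h
      exact hn ⟨n - a, by simp; omega⟩
    simp [Nat.choose_eq_zero_of_lt this]
  rw [← Equiv.pnatEquivNat.hasSum_iff] at h2
  refine h2.congr_fun fun m => ?_
  have : m.natPred + 1 = (m : ℕ) := PNat.natPred_add_one m
  simp only [Function.comp_apply, Equiv.pnatEquivNat_apply, this]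
  rfl

/-- The partial sum `m_1 γ_1 + ⋯ + m_j γ_j`. -/
def partialSum {r : ℕ} (γ : Fin r → ℂ) (m : Fin r → ℕ+) (j : Fin r) : ℂ :=
  ∑ k ∈ Finset.Iic j, ((m k : ℕ) : ℂ) * γ k

theorem mul_re_le_partialSum_re {r : ℕ} {γ : Fin r → ℂ} (hγ : ∀ j, 0 < (γ j).re)
    (m : Fin r → ℕ+) (j : Fin r) : (m j : ℕ) * (γ j).re ≤ (partialSum γ m j).re := by
  rw [partialSum, Complex.re_sum]
  refine le_trans (le_of_eq ?_) (Finset.single_le_sum (fun k _ => ?_) (Finset.mem_Iic.2 le_rfl))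
  · simp
  · have := (hγ k).le
    simp only [Complex.mul_re, Complex.natCast_re, Complex.natCast_im, zero_mul, sub_zero]
    positivity

theorem partialSum_re_pos {r : ℕ} {γ : Fin r → ℂ} (hγ : ∀ j, 0 < (γ j).re)
    (m : Fin r → ℕ+) (j : Fin r) : 0 < (partialSum γ m j).re :=
  lt_of_lt_of_le (mul_pos (by exact_mod_cast (m j).pos) (hγ j)) (mul_re_le_partialSum_re hγ m j)

theorem partialSum_ne_zero {r : ℕ} {γ : Fin r → ℂ} (hγ : ∀ j, 0 < (γ j).re)
    (m : Fin r → ℕ+) (j : Fin r) : partialSum γ m j ≠ 0 := fun h => by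
  simpa [h] using partialSum_re_pos hγ m j

theorem zetaTerm_eq {r : ℕ} (ξ γ s : Fin r → ℂ) (m : Fin r → ℕ+) :
    zetaTerm ξ γ s m = (∏ j, ξ j ^ (m j : ℕ)) * ∏ j, partialSum γ m j ^ (-s j) := by
  rw [zetaTerm, Finset.prod_mul_distrib]
  rfl

/-- The weight `∏_j binom(m_j - 1, a_j)`. -/
def chooseWeight {r : ℕ} (a : Fin r → ℕ) (m : Fin r → ℕ+) : ℂ :=
  ∏ j, (((m j : ℕ) - 1).choose (a j) : ℂ)

/-- A double sum over j ≤ k read in both orders: initial sums in m are dual to tail sums in t. For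
each fixed m the integral therefore splits into one-variable Gamma integrals. -/
theorem sum_mul_tail_eq {r : ℕ} (γ : Fin r → ℂ) (m : Fin r → ℕ+) (t : Fin r → ℝ) :
    ∑ j, ((m j : ℕ) : ℂ) * (γ j * ((∑ k ∈ Finset.Ici j, t k : ℝ) : ℂ)) =
      ∑ k, partialSum γ m k * t k := by
  simp only [partialSum, Complex.ofReal_sum, Finset.mul_sum, Finset.sum_mul]
  rw [Finset.sum_comm' (t' := Finset.univ) (s' := fun k => Finset.Iic k)]
  · refine Finset.sum_congr rfl fun k _ => Finset.sum_congr rfl fun j _ => ?_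
    ring
  · simp

theorem prod_geom_eq {r : ℕ} (ξ γ s : Fin r → ℂ) (a : Fin r → ℕ) (m : Fin r → ℕ+)
    (t : Fin r → ℝ) :
    (∏ j, (t j : ℂ) ^ (s j - 1)) * ∏ j, ((((m j : ℕ) - 1).choose (a j) : ℂ) *
        (ξ j * Complex.exp (-(γ j * ((∑ k ∈ Finset.Ici j, t k : ℝ) : ℂ)))) ^ (m j : ℕ)) =
      (chooseWeight a m * ∏ j, ξ j ^ (m j : ℕ)) *
        ∏ j, ((t j : ℂ) ^ (s j - 1) * Complex.exp (-(partialSum γ m j * t j))) := by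
  have h : ∏ j, Complex.exp (-(γ j * ((∑ k ∈ Finset.Ici j, t k : ℝ) : ℂ))) ^ (m j : ℕ) =
      ∏ j, Complex.exp (-(partialSum γ m j * t j)) := by
    simp_rw [← Complex.exp_nat_mul]
    rw [← Complex.exp_sum, ← Complex.exp_sum, Finset.sum_neg_distrib, ← sum_mul_tail_eq,
      ← Finset.sum_neg_distrib]
    congr 1
    exact Finset.sum_congr rfl fun j _ => by ring
  simp only [mul_pow, Finset.prod_mul_distrib]
  rw [h, chooseWeight]
  ring

/-- The terms of the multiple series, weighted by `∏_j binom(m_j - 1, a_j)`. -/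
def weightedTerm {r : ℕ} (ξ γ : Fin r → ℂ) (a : Fin r → ℕ) (s : Fin r → ℂ) (m : Fin r → ℕ+) : ℂ :=
  chooseWeight a m * zetaTerm ξ γ s m

/-- The Mellin transform of `multiKernel`, divided by the Gamma factors. -/
def normalizedMellin {r : ℕ} (ξ γ : Fin r → ℂ) (a : Fin r → ℕ) (s : Fin r → ℂ) : ℂ :=
  (∏ j, (Complex.Gamma (s j))⁻¹) * mellinIntegral ξ γ a s

theorem summable_pnat_rpow {p : ℝ} (hp : p < -1) : Summable fun m : ℕ+ => ((m : ℕ) : ℝ) ^ p :=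
  (Real.summable_nat_rpow.2 hp).comp_injective PNat.coe_injective

theorem integrable_prod_cpow_mul_cexp {r : ℕ} {s z : Fin r → ℂ} (hs : ∀ j, 0 < (s j).re)
    (hz : ∀ j, 0 < (z j).re) :
    Integrable (fun t : Fin r → ℝ => ∏ j, ((t j : ℂ) ^ (s j - 1) * Complex.exp (-(z j * t j))))
      (orthantMeasure r) :=
  Integrable.fintype_prod (f := fun j (x : ℝ) => (x : ℂ) ^ (s j - 1) * Complex.exp (-(z j * x)))
    fun j => integrableOn_cpow_mul_cexp (hs j) (hz j)

theorem integral_prod_cpow_mul_cexp {r : ℕ} {s z : Fin r → ℂ} (hs : ∀ j, 0 < (s j).re)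
    (hz : ∀ j, 0 < (z j).re) :
    ∫ t : Fin r → ℝ, ∏ j, ((t j : ℂ) ^ (s j - 1) * Complex.exp (-(z j * t j))) ∂orthantMeasure r =
      ∏ j, (z j ^ (-s j) * Complex.Gamma (s j)) := by
  rw [orthantMeasure, integral_fintype_prod_eq_prod
    (f := fun j (x : ℝ) => (x : ℂ) ^ (s j - 1) * Complex.exp (-(z j * x)))]
  exact Finset.prod_congr rfl fun j _ => integral_cpow_mul_cexp (hs j) (hz j)

theorem integral_prod_rpow_mul_exp {r : ℕ} {σ c : Fin r → ℝ} (hσ : ∀ j, 0 < σ j)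
    (hc : ∀ j, 0 < c j) :
    ∫ t : Fin r → ℝ, ∏ j, (t j ^ (σ j - 1) * Real.exp (-(c j * t j))) ∂orthantMeasure r =
      ∏ j, ((1 / c j) ^ σ j * Real.Gamma (σ j)) := by
  rw [orthantMeasure, integral_fintype_prod_eq_prod
    (f := fun j (x : ℝ) => x ^ (σ j - 1) * Real.exp (-(c j * x)))]
  exact Finset.prod_congr rfl fun j _ => Real.integral_rpow_mul_exp_neg_mul_Ioi (hσ j) (hc j)

theorem norm_chooseWeight_le {r : ℕ} (a : Fin r → ℕ) (m : Fin r → ℕ+) :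
    ‖chooseWeight a m‖ ≤ ∏ j, ((m j : ℕ) : ℝ) ^ a j := by
  rw [chooseWeight, norm_prod]
  refine Finset.prod_le_prod (fun _ _ => norm_nonneg _) fun j _ => ?_
  rw [Complex.norm_natCast]
  exact_mod_cast (Nat.choose_le_pow _ _).trans (Nat.pow_le_pow_left (Nat.sub_le _ _) _)

/-- For large real parts, the weighted series is the Mellin transform of `multiKernel`. -/
theorem hasSum_weightedTerm {r : ℕ} {ξ γ : Fin r → ℂ} (hξ : ∀ j, ‖ξ j‖ = 1)
    (hγ : ∀ j, 0 < (γ j).re) (a : Fin r → ℕ) {s : Fin r → ℂ}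
    (hs : ∀ j, (a j : ℝ) + 1 < (s j).re) :
    HasSum (weightedTerm ξ γ a s) (normalizedMellin ξ γ a s) := by
  have hs0 : ∀ j, 0 < (s j).re := fun j => by
    have : (0 : ℝ) ≤ a j := Nat.cast_nonneg _
    linarith [hs j]
  set F : (Fin r → ℕ+) → (Fin r → ℝ) → ℂ := fun m t =>
    (chooseWeight a m * ∏ j, ξ j ^ (m j : ℕ)) *
      ∏ j, ((t j : ℂ) ^ (s j - 1) * Complex.exp (-(partialSum γ m j * t j))) with hF
  have hInt : ∀ m, Integrable (F m) (orthantMeasure r) := fun m =>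
    (integrable_prod_cpow_mul_cexp hs0 (partialSum_re_pos hγ m)).const_mul _
  have hnorm : ∀ m, ∫ t, ‖F m t‖ ∂orthantMeasure r =
      ‖chooseWeight a m‖ * ∏ j, ((1 / (partialSum γ m j).re) ^ (s j).re *
        Real.Gamma ((s j).re)) := by
    intro m
    rw [← integral_prod_rpow_mul_exp hs0 (partialSum_re_pos hγ m), ← integral_const_mul]
    refine integral_congr_ae ?_
    filter_upwards [ae_orthantMeasure_pos r] with t ht
    simp only [hF, norm_mul, norm_prod, norm_pow, hξ, one_pow, Finset.prod_const_one, mul_one]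
    congr 1
    refine Finset.prod_congr rfl fun j _ => ?_
    rw [← norm_mul, norm_cpow_mul_cexp (ht j)]
  -- This justifies exchanging sum and integral: the partial sum up to j has real part at least m_j
  -- Re γ_j, which leaves ∏ m_j^(a_j - Re s_j) with every exponent below -1.
  have hsum : Summable fun m => ∫ t, ‖F m t‖ ∂orthantMeasure r := by
    have hb : Summable fun m : Fin r → ℕ+ => ∏ j, ((1 / (γ j).re) ^ (s j).re *
        Real.Gamma ((s j).re) * ((m j : ℕ) : ℝ) ^ ((a j : ℝ) - (s j).re)) :=
      summable_pi_prod_real (fun j (i : ℕ+) => (1 / (γ j).re) ^ (s j).re *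
        Real.Gamma ((s j).re) * ((i : ℕ) : ℝ) ^ ((a j : ℝ) - (s j).re))
        (fun j => (summable_pnat_rpow (by linarith [hs j])).mul_left _)
        (fun j i => by
          have := Real.Gamma_pos_of_pos (hs0 j)
          have := hγ j
          positivity)
    refine Summable.of_nonneg_of_le (fun m => integral_nonneg fun t => norm_nonneg _)
      (fun m => ?_) hb
    rw [hnorm]
    refine (mul_le_mul_of_nonneg_right (norm_chooseWeight_le a m)
      (Finset.prod_nonneg fun j _ => ?_)).trans ?_
    · have := Real.Gamma_pos_of_pos (hs0 j)
      have := partialSum_re_pos hγ m j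
      positivity
    · rw [← Finset.prod_mul_distrib]
      refine Finset.prod_le_prod (fun j _ => ?_) fun j _ => ?_
      · have := Real.Gamma_pos_of_pos (hs0 j)
        have := partialSum_re_pos hγ m j
        positivity
      · have hG := Real.Gamma_pos_of_pos (hs0 j)
        have hz := partialSum_re_pos hγ m j
        have hm : (0 : ℝ) < (m j : ℕ) := by exact_mod_cast (m j).pos
        have hg := hγ j
        have h1 : (1 / (partialSum γ m j).re) ^ (s j).re ≤
            (1 / (((m j : ℕ) : ℝ) * (γ j).re)) ^ (s j).re := by
          have := mul_re_le_partialSum_re hγ m j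
          have := (hs0 j).le
          gcongr
        have h2 : (1 / (((m j : ℕ) : ℝ) * (γ j).re)) ^ (s j).re =
            (1 / (γ j).re) ^ (s j).re * ((m j : ℕ) : ℝ) ^ (-(s j).re) := by
          rw [one_div, mul_inv, Real.mul_rpow (by positivity) (by positivity), Real.rpow_neg hm.le,
            Real.inv_rpow hm.le, one_div, mul_comm]
        calc _ ≤ ((m j : ℕ) : ℝ) ^ a j * ((1 / (γ j).re) ^ (s j).re *
              ((m j : ℕ) : ℝ) ^ (-(s j).re) * Real.Gamma ((s j).re)) := by
                rw [← h2]
                gcongr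
          _ = _ := by
                rw [sub_eq_add_neg, Real.rpow_add hm, Real.rpow_natCast]
                ring
  have key := hasSum_integral_of_summable_integral_norm hInt hsum
  have hL : ∀ m, ∫ t, F m t ∂orthantMeasure r =
      (∏ j, Complex.Gamma (s j)) * weightedTerm ξ γ a s m := by
    intro m
    rw [hF]
    simp only
    rw [integral_const_mul, integral_prod_cpow_mul_cexp hs0 (partialSum_re_pos hγ m),
      Finset.prod_mul_distrib, weightedTerm, zetaTerm_eq]
    ring
  have hR : ∫ t, ∑' m, F m t ∂orthantMeasure r = mellinIntegral ξ γ a s := by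
    refine integral_congr_ae ?_
    filter_upwards [ae_orthantMeasure_pos r] with t ht
    have hx : ∀ j, ‖ξ j * Complex.exp (-(γ j * ((∑ k ∈ Finset.Ici j, t k : ℝ) : ℂ)))‖ < 1 := by
      intro j
      rw [norm_mul_cexp_eq (hξ j), Real.exp_lt_one_iff]
      have : 0 < ∑ k ∈ Finset.Ici j, t k :=
        Finset.sum_pos (fun k _ => ht k) ⟨j, Finset.mem_Ici.2 le_rfl⟩
      have := mul_pos (hγ j) this
      linarith
    have h1 := (hasSum_pi_prod (fun j (i : ℕ+) => (((i : ℕ) - 1).choose (a j) : ℂ) *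
      (ξ j * Complex.exp (-(γ j * ((∑ k ∈ Finset.Ici j, t k : ℝ) : ℂ)))) ^ (i : ℕ))
      (fun j => (hasSum_choose_mul_pow (hx j) (a j)).summable.norm)).2
    have h2 := h1.mul_left (∏ j, (t j : ℂ) ^ (s j - 1))
    simp_rw [prod_geom_eq] at h2
    rw [h2.tsum_eq, multiKernel]
    congr 1
    exact Finset.prod_congr rfl fun j _ => (hasSum_choose_mul_pow (hx j) (a j)).tsum_eq
  rw [hR] at key
  simp_rw [hL] at key
  have h3 := key.mul_left (∏ j, (Complex.Gamma (s j))⁻¹)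
  have hne : (∏ j, (Complex.Gamma (s j))⁻¹) * ∏ j, Complex.Gamma (s j) = 1 := by
    rw [← Finset.prod_mul_distrib]
    exact Finset.prod_eq_one fun j _ =>
      inv_mul_cancel₀ (Complex.Gamma_ne_zero_of_re_pos (hs0 j))
  refine h3.congr_fun fun m => ?_
  rw [← mul_assoc, hne, one_mul]

/-! ### The recurrence lowering s_j. -/

theorem zetaTerm_eq_partialSum_mul {r : ℕ} {γ : Fin r → ℂ} (hγ : ∀ j, 0 < (γ j).re)
    (ξ s : Fin r → ℂ) (m : Fin r → ℕ+) (j : Fin r) :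
    zetaTerm ξ γ s m = partialSum γ m j * zetaTerm ξ γ (s + Pi.single j 1) m := by
  have h : ∏ i, partialSum γ m i ^ (-s i) =
      partialSum γ m j * ∏ i, partialSum γ m i ^ (-(s + Pi.single j 1 : Fin r → ℂ) i) := by
    rw [Fintype.prod_eq_mul_prod_compl j, Fintype.prod_eq_mul_prod_compl j, ← mul_assoc]
    congr 1
    · have h0 := partialSum_ne_zero hγ m j
      have : -s j = 1 + -(s j + 1) := by ring
      rw [Pi.add_apply, Pi.single_eq_same, this, Complex.cpow_add _ _ h0, Complex.cpow_one]
    · refine Finset.prod_congr rfl fun i hi => ?_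
      have : i ≠ j := by simpa using hi
      simp [this]
  rw [zetaTerm_eq, zetaTerm_eq, h]
  ring

/-- Combines m binom(m-1, a) = (a+1) binom(m, a+1) with Pascal's rule. The binomial weights are thus
closed under multiplication by m_k. -/
theorem mul_chooseWeight {r : ℕ} (a : Fin r → ℕ) (m : Fin r → ℕ+) (k : Fin r) :
    ((m k : ℕ) : ℂ) * chooseWeight a m =
      (a k + 1) * (chooseWeight a m + chooseWeight (a + Pi.single k 1) m) := by
  have h1 : ((m k : ℕ) : ℂ) * (((m k : ℕ) - 1).choose (a k) : ℂ) =
      (a k + 1) * ((((m k : ℕ) - 1).choose (a k) : ℂ) + (((m k : ℕ) - 1).choose (a k + 1) : ℂ)) := by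
    obtain ⟨n, hn⟩ : ∃ n, (m k : ℕ) = n + 1 := ⟨_, (PNat.natPred_add_one (m k)).symm⟩
    rw [hn, Nat.add_sub_cancel]
    have h2 := Nat.add_one_mul_choose_eq n (a k)
    rw [Nat.choose_succ_succ'] at h2
    rw [mul_comm ((a k : ℂ) + 1)]
    exact_mod_cast h2
  have h3 : ∀ b : Fin r → ℕ, chooseWeight b m = (((m k : ℕ) - 1).choose (b k) : ℂ) *
      ∏ i ∈ {k}ᶜ, (((m i : ℕ) - 1).choose (b i) : ℂ) := fun b =>
    Fintype.prod_eq_mul_prod_compl k _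
  have h4 : ∏ i ∈ {k}ᶜ, (((m i : ℕ) - 1).choose ((a + Pi.single k 1 : Fin r → ℕ) i) : ℂ) =
      ∏ i ∈ {k}ᶜ, (((m i : ℕ) - 1).choose (a i) : ℂ) := by
    refine Finset.prod_congr rfl fun i hi => ?_
    have : i ≠ k := by simpa using hi
    simp [this]
  rw [h3 a, h3 (a + _), h4, Pi.add_apply, Pi.single_eq_same]
  linear_combination (∏ i ∈ {k}ᶜ, (((m i : ℕ) - 1).choose (a i) : ℂ)) * h1

theorem weightedTerm_recurrence {r : ℕ} {γ : Fin r → ℂ} (hγ : ∀ j, 0 < (γ j).re)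
    (ξ s : Fin r → ℂ) (a : Fin r → ℕ) (m : Fin r → ℕ+) (j : Fin r) :
    weightedTerm ξ γ a s m = ∑ k ∈ Finset.Iic j, γ k * (a k + 1) *
      (weightedTerm ξ γ a (s + Pi.single j 1) m +
        weightedTerm ξ γ (a + Pi.single k 1) (s + Pi.single j 1) m) := by
  rw [weightedTerm, zetaTerm_eq_partialSum_mul hγ ξ s m j, partialSum, Finset.sum_mul,
    Finset.mul_sum]
  refine Finset.sum_congr rfl fun k _ => ?_
  simp only [weightedTerm]
  linear_combination (γ k * zetaTerm ξ γ (s + Pi.single j 1) m) * mul_chooseWeight a m k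

/-! ### Continuation to all of ℂ^r. -/

/-- The region `Re s_j > -ν_j` for all `j`. -/
def shiftedOrthant {r : ℕ} (ν : Fin r → ℝ) : Set (Fin r → ℂ) :=
  {s | ∀ j, -ν j < (s j).re}

theorem isOpen_shiftedOrthant {r : ℕ} (ν : Fin r → ℝ) : IsOpen (shiftedOrthant ν) := by
  simp only [shiftedOrthant, ofPred_forall]
  exact isOpen_iInter_of_finite fun j => isOpen_lt continuous_const (by fun_prop)

theorem convex_shiftedOrthant {r : ℕ} (ν : Fin r → ℝ) : Convex ℝ (shiftedOrthant ν) := by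
  intro x hx y hy p q hp hq hpq j
  have h1 := hx j
  have h2 := hy j
  simp only [Pi.add_apply, Pi.smul_apply, Complex.add_re, Complex.real_smul, Complex.re_ofReal_mul]
  have : p * -ν j + q * -ν j = -ν j := by rw [← add_mul, hpq, one_mul]
  rcases hp.eq_or_lt with rfl | hp'
  · have : q = 1 := by linarith
    subst this
    linarith
  · have := mul_lt_mul_of_pos_left h1 hp'
    have := mul_le_mul_of_nonneg_left h2.le hq
    linarith

theorem add_single_mem_shiftedOrthant_zero {r : ℕ} {s : Fin r → ℂ} (hs : s ∈ shiftedOrthant 0)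
    (j : Fin r) : s + Pi.single j 1 ∈ shiftedOrthant 0 := by
  intro i
  have := hs i
  by_cases h : i = j
  · subst h
    simp at this ⊢
    linarith
  · simpa [h] using this

theorem differentiableAt_fintype_prod {𝕜 E ι : Type*} [NontriviallyNormedField 𝕜]
    [NormedAddCommGroup E] [NormedSpace 𝕜 E] [NormedAlgebra 𝕜 ℂ] [Fintype ι] {f : ι → E → ℂ} {x : E}
    (hf : ∀ i, DifferentiableAt 𝕜 (f i) x) : DifferentiableAt 𝕜 (fun y => ∏ i, f i y) x := by
  classical
  exact (HasFDerivAt.finsetProd (u := Finset.univ) fun i _ => (hf i).hasFDerivAt).differentiableAt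

theorem differentiableOn_normalizedMellin {r : ℕ} {ξ γ : Fin r → ℂ} (hξ : ∀ j, ‖ξ j‖ = 1)
    (hξ1 : ∀ j, ξ j ≠ 1) (hγ : ∀ j, 0 < (γ j).re) (a : Fin r → ℕ) :
    DifferentiableOn ℂ (normalizedMellin ξ γ a) (shiftedOrthant 0) := by
  intro s hs
  refine DifferentiableAt.differentiableWithinAt ?_
  refine DifferentiableAt.mul ?_ (differentiableAt_mellinIntegral hξ hξ1 hγ a
    fun j => by simpa using hs j)
  refine differentiableAt_fintype_prod fun j => ?_
  exact DifferentiableAt.comp (g := fun z : ℂ => (Complex.Gamma z)⁻¹) s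
    (Complex.differentiable_one_div_Gamma (s j)) (differentiableAt_apply j s)

/-- Holds termwise where the series converge, and spreads to Re s_j > 0 by the identity theorem. -/
theorem normalizedMellin_recurrence {r : ℕ} {ξ γ : Fin r → ℂ} (hξ : ∀ j, ‖ξ j‖ = 1)
    (hξ1 : ∀ j, ξ j ≠ 1) (hγ : ∀ j, 0 < (γ j).re) (a : Fin r → ℕ) (j : Fin r) :
    EqOn (normalizedMellin ξ γ a) (fun s => ∑ k ∈ Finset.Iic j, γ k * (a k + 1) *
      (normalizedMellin ξ γ a (s + Pi.single j 1) +
        normalizedMellin ξ γ (a + Pi.single k 1) (s + Pi.single j 1))) (shiftedOrthant 0) := by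
  have hd : ∀ b : Fin r → ℕ, DifferentiableOn ℂ
      (fun s : Fin r → ℂ => normalizedMellin ξ γ b (s + Pi.single j 1)) (shiftedOrthant 0) :=
    fun b => (differentiableOn_normalizedMellin hξ hξ1 hγ b).comp (by fun_prop)
      fun s hs => add_single_mem_shiftedOrthant_zero hs j
  -- Around a + 3 one has Re s_i > a_i + 2, which also covers the series whose weight index is
  -- raised to a + e_k.
  have hmem : (fun i => ((a i : ℂ) + 3)) ∈ shiftedOrthant (fun i => -((a i : ℝ) + 2)) := by
    intro i
    simp
    norm_num
  refine eqOn_of_differentiableOn (isOpen_shiftedOrthant 0) (convex_shiftedOrthant 0)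
    (differentiableOn_normalizedMellin hξ hξ1 hγ a)
    (DifferentiableOn.fun_sum fun k _ => ((hd a).add (hd _)).const_mul _)
    (x := fun i => (a i : ℂ) + 3) ?_ ?_
  · intro i
    simp
    positivity
  · filter_upwards [(isOpen_shiftedOrthant _).mem_nhds hmem] with s hs
    have hs' : ∀ i, (a i : ℝ) + 2 < (s i).re := fun i => by simpa using hs i
    have hre : ∀ i, (s i).re ≤ ((s + Pi.single j 1 : Fin r → ℂ) i).re := by
      intro i
      by_cases h : i = j
      · subst h
        simp
      · simp [h]
    have h1 := hasSum_weightedTerm hξ hγ a (s := s) fun i => by linarith [hs' i]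
    have h2 := hasSum_weightedTerm hξ hγ a (s := s + Pi.single j 1) fun i => by
      linarith [hs' i, hre i]
    have h3 : ∀ k, HasSum (weightedTerm ξ γ (a + Pi.single k 1) (s + Pi.single j 1))
        (normalizedMellin ξ γ (a + Pi.single k 1) (s + Pi.single j 1)) := fun k =>
      hasSum_weightedTerm hξ hγ (a + Pi.single k 1) (s := s + Pi.single j 1) fun i => by
        have : (((a + Pi.single k 1 : Fin r → ℕ) i : ℕ) : ℝ) ≤ a i + 1 := by
          by_cases h : i = k
          · subst h
            simp
          · simp [h]
        linarith [hs' i, hre i]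
    refine h1.unique ?_
    simp_rw [funext fun m => weightedTerm_recurrence hγ ξ s a m j]
    exact hasSum_sum fun k _ => (h2.add (h3 k)).mul_left _

theorem add_single_mem_shiftedOrthant {r : ℕ} {ν : Fin r → ℕ} {j : Fin r} {s : Fin r → ℂ}
    (hs : s ∈ shiftedOrthant fun i => (((ν + Pi.single j 1 : Fin r → ℕ) i : ℕ) : ℝ)) :
    s + Pi.single j 1 ∈ shiftedOrthant fun i => (ν i : ℝ) := by
  intro i
  have := hs i
  by_cases h : i = j
  · subst h
    simp at this ⊢
    linarith
  · simpa [h] using this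

theorem shiftedOrthant_mono {r : ℕ} {ν μ : Fin r → ℝ} (h : ν ≤ μ) :
    shiftedOrthant ν ⊆ shiftedOrthant μ := fun _ hs j => lt_of_le_of_lt (neg_le_neg (h j)) (hs j)

/-- Continuation of `normalizedMellin` to the region `Re s_j > -ν_j`. -/
theorem exists_continuation_shiftedOrthant {r : ℕ} {ξ γ : Fin r → ℂ} (hξ : ∀ j, ‖ξ j‖ = 1)
    (hξ1 : ∀ j, ξ j ≠ 1) (hγ : ∀ j, 0 < (γ j).re) (ν : Fin r → ℕ) :
    ∀ a : Fin r → ℕ, ∃ G : (Fin r → ℂ) → ℂ,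
      DifferentiableOn ℂ G (shiftedOrthant fun i => (ν i : ℝ)) ∧
        EqOn G (normalizedMellin ξ γ a) (shiftedOrthant 0) := by
  -- The statement covers all a at once because the recurrence raises a while it moves the region
  -- left.
  induction hN : ∑ i, ν i generalizing ν with
  | zero =>
    intro a
    have h0 : (fun i => (ν i : ℝ)) = 0 := by
      funext i
      have := (Finset.sum_eq_zero_iff.1 hN) i (Finset.mem_univ i)
      simp [this]
    rw [h0]
    exact ⟨_, differentiableOn_normalizedMellin hξ hξ1 hγ a, fun _ _ => rfl⟩
  | succ N ih =>
    obtain ⟨j, -, hj⟩ : ∃ j ∈ Finset.univ, ν j ≠ 0 := by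
      by_contra! h
      rw [Finset.sum_eq_zero h] at hN
      omega
    obtain ⟨ν', rfl⟩ : ∃ ν' : Fin r → ℕ, ν = ν' + Pi.single j 1 := by
      refine ⟨ν - Pi.single j 1, ?_⟩
      funext i
      by_cases h : i = j
      · subst h
        simp
        omega
      · simp [h]
    have hN' : ∑ i, ν' i = N := by
      simp only [Pi.add_apply, Finset.sum_add_distrib, Finset.sum_pi_single', Finset.mem_univ,
        if_true] at hN
      omega
    choose G hG hGE using ih ν' hN'
    intro a
    -- The right side of the recurrence only evaluates at s + e_j, so it serves as the definition on
    -- the larger region.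
    refine ⟨fun s => ∑ k ∈ Finset.Iic j, γ k * (a k + 1) *
      (G a (s + Pi.single j 1) + G (a + Pi.single k 1) (s + Pi.single j 1)), ?_, ?_⟩
    · have hd : ∀ b, DifferentiableOn ℂ (fun s : Fin r → ℂ => G b (s + Pi.single j 1))
          (shiftedOrthant fun i => (((ν' + Pi.single j 1 : Fin r → ℕ) i : ℕ) : ℝ)) := fun b =>
        (hG b).comp (by fun_prop) fun s hs => add_single_mem_shiftedOrthant hs
      exact DifferentiableOn.fun_sum fun k _ => ((hd a).add (hd _)).const_mul _
    · intro s hs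
      rw [normalizedMellin_recurrence hξ hξ1 hγ a j hs]
      simp only [hGE _ (add_single_mem_shiftedOrthant_zero hs j)]

/-- Continuation of `normalizedMellin` to an entire function. -/
theorem exists_entire_continuation {r : ℕ} {ξ γ : Fin r → ℂ} (hξ : ∀ j, ‖ξ j‖ = 1)
    (hξ1 : ∀ j, ξ j ≠ 1) (hγ : ∀ j, 0 < (γ j).re) (a : Fin r → ℕ) :
    ∃ Z : (Fin r → ℂ) → ℂ, Differentiable ℂ Z ∧
      EqOn Z (normalizedMellin ξ γ a) (shiftedOrthant 0) := by
  choose G hG hGE using fun N : ℕ =>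
    exists_continuation_shiftedOrthant hξ hξ1 hγ (fun _ : Fin r => N) a
  have hone : (1 : Fin r → ℂ) ∈ shiftedOrthant (0 : Fin r → ℝ) := fun j => by simp
  have hle : ∀ {M N : ℕ}, M ≤ N → EqOn (G M) (G N) (shiftedOrthant fun _ => (M : ℝ)) := by
    intro M N hMN
    refine eqOn_of_differentiableOn (isOpen_shiftedOrthant _) (convex_shiftedOrthant _) (hG M)
      ((hG N).mono (shiftedOrthant_mono fun _ => Nat.cast_le.2 hMN)) (x := 1)
      (shiftedOrthant_mono (fun _ => Nat.cast_nonneg M) hone) ?_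
    filter_upwards [(isOpen_shiftedOrthant 0).mem_nhds hone] with s hs
    rw [hGE M hs, hGE N hs]
  -- Glue: N(s) > ‖s‖ puts s in region number N(s), and by `hle` the choice of region does not
  -- affect the value.
  let N : (Fin r → ℂ) → ℕ := fun s => ⌊‖s‖⌋₊ + 1
  have hN : ∀ s, s ∈ shiftedOrthant fun _ => (N s : ℝ) := by
    intro s j
    have h1 : ‖s‖ < N s := by
      simpa [N] using Nat.lt_floor_add_one ‖s‖
    have h2 := (Complex.abs_re_le_norm (s j)).trans (norm_le_pi_norm s j)
    linarith [neg_abs_le (s j).re]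
  have hZ : ∀ (M : ℕ) (s : Fin r → ℂ), s ∈ (shiftedOrthant fun _ => (M : ℝ)) → G (N s) s = G M s := by
    intro M s hs
    rcases le_total M (N s) with h | h
    · exact (hle h hs).symm
    · exact hle h (hN s)
  refine ⟨fun s => G (N s) s, fun s => ?_, fun s hs => hGE _ hs⟩
  have hnb := (isOpen_shiftedOrthant _).mem_nhds (hN s)
  refine ((hG (N s)).differentiableAt hnb).congr_of_eventuallyEq ?_
  filter_upwards [hnb] with w hw
  exact hZ _ _ hw

theorem entire_recurrence {r : ℕ} {ξ γ : Fin r → ℂ} (hξ : ∀ j, ‖ξ j‖ = 1)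
    (hξ1 : ∀ j, ξ j ≠ 1) (hγ : ∀ j, 0 < (γ j).re) {Z : (Fin r → ℕ) → (Fin r → ℂ) → ℂ}
    (hZ : ∀ a, Differentiable ℂ (Z a))
    (hZE : ∀ a, EqOn (Z a) (normalizedMellin ξ γ a) (shiftedOrthant 0)) (a : Fin r → ℕ)
    (j : Fin r) (s : Fin r → ℂ) :
    Z a s = ∑ k ∈ Finset.Iic j, γ k * (a k + 1) *
      (Z a (s + Pi.single j 1) + Z (a + Pi.single k 1) (s + Pi.single j 1)) := by
  have hone : (1 : Fin r → ℂ) ∈ shiftedOrthant (0 : Fin r → ℝ) := fun j => by simp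
  have hd : ∀ b, Differentiable ℂ (fun s : Fin r → ℂ => Z b (s + Pi.single j 1)) := fun b =>
    (hZ b).comp (by fun_prop)
  have hR : Differentiable ℂ fun s => ∑ k ∈ Finset.Iic j, γ k * (a k + 1) *
      (Z a (s + Pi.single j 1) + Z (a + Pi.single k 1) (s + Pi.single j 1)) :=
    Differentiable.fun_sum fun k _ => ((hd a).add (hd _)).const_mul _
  suffices h : Z a =ᶠ[𝓝 1] fun s => ∑ k ∈ Finset.Iic j, γ k * (a k + 1) *
      (Z a (s + Pi.single j 1) + Z (a + Pi.single k 1) (s + Pi.single j 1)) from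
    eqOn_of_differentiableOn isOpen_univ convex_univ (hZ a).differentiableOn hR.differentiableOn
      (mem_univ 1) h (mem_univ s)
  filter_upwards [(isOpen_shiftedOrthant 0).mem_nhds hone] with s hs
  simp only [hZE _ hs, hZE _ (add_single_mem_shiftedOrthant_zero hs j)]
  exact normalizedMellin_recurrence hξ hξ1 hγ a j hs

/-! ### The value at the origin. -/

theorem multiKernel_zero {r : ℕ} (ξ γ : Fin r → ℂ) (a : Fin r → ℕ) :
    multiKernel ξ γ a 0 = ∏ j, (ξ j / (1 - ξ j)) ^ (a j + 1) := by
  simp [multiKernel, geomKernel]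

theorem differentiableAt_multiKernel_zero {r : ℕ} {ξ γ : Fin r → ℂ} (hξ1 : ∀ j, ξ j ≠ 1)
    (a : Fin r → ℕ) : DifferentiableAt ℝ (multiKernel ξ γ a) 0 := by
  have hE : ∀ j, DifferentiableAt ℝ (fun t : Fin r → ℝ =>
      ξ j * Complex.exp (-(γ j * ((∑ k ∈ Finset.Ici j, t k : ℝ) : ℂ)))) 0 := by
    intro j
    have h1 : DifferentiableAt ℝ (fun t : Fin r → ℝ => ((∑ k ∈ Finset.Ici j, t k : ℝ) : ℂ)) 0 :=
      Complex.ofRealCLM.differentiableAt.comp (0 : Fin r → ℝ)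
        (DifferentiableAt.fun_sum fun k _ => differentiableAt_apply k _)
    exact ((h1.const_mul (γ j)).neg.cexp).const_mul (ξ j)
  refine differentiableAt_fintype_prod fun j => DifferentiableAt.pow ?_ _
  simp only [geomKernel, div_eq_mul_inv]
  refine (hE j).mul (DifferentiableAt.inv ((differentiableAt_const _).sub (hE j)) ?_)
  simpa [sub_eq_zero] using (hξ1 j).symm

/-- Near the origin and at infinity, `multiKernel` is close to an exponential with the same value
at the origin. -/
theorem exists_norm_multiKernel_sub_le {r : ℕ} {ξ γ : Fin r → ℂ} (hξ : ∀ j, ‖ξ j‖ = 1)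
    (hξ1 : ∀ j, ξ j ≠ 1) (hγ : ∀ j, 0 < (γ j).re) (a : Fin r → ℕ) :
    ∃ c K : ℝ, 0 < c ∧ 0 ≤ K ∧ ∀ t : Fin r → ℝ, (∀ j, 0 ≤ t j) →
      ‖multiKernel ξ γ a t - multiKernel ξ γ a 0 * ∏ j, Complex.exp (-(t j : ℂ))‖ ≤
        K * ((∑ j, t j) * ∏ j, Real.exp (-(c * t j))) := by
  obtain ⟨C, hC, hb⟩ := exists_norm_multiKernel_le hξ hξ1 hγ a
  obtain ⟨c₀, hc₀, hcγ⟩ := Pi.exists_forall_pos_add_lt hγ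
  simp only [zero_add] at hcγ
  set c := min c₀ 1 with hc
  have hc0 : 0 < c := lt_min hc₀ one_pos
  set f : (Fin r → ℝ) → ℂ := fun t =>
    multiKernel ξ γ a t - multiKernel ξ γ a 0 * ∏ j, Complex.exp (-(t j : ℂ)) with hf
  have hf0 : f 0 = 0 := by simp [hf]
  have hfd : DifferentiableAt ℝ f 0 := by
    refine (differentiableAt_multiKernel_zero hξ1 a).sub (DifferentiableAt.const_mul ?_ _)
    refine differentiableAt_fintype_prod fun j => ?_
    have h1 : DifferentiableAt ℝ (fun t : Fin r → ℝ => ((t j : ℝ) : ℂ)) 0 :=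
      Complex.ofRealCLM.differentiableAt.comp (0 : Fin r → ℝ) (by fun_prop)
    exact h1.neg.cexp
  -- The difference vanishes at 0 and is differentiable there, so it is O(‖t‖).
  obtain ⟨C₂, hC₂, hO⟩ := hfd.isBigO_sub.exists_pos
  rw [Asymptotics.isBigOWith_iff, Metric.eventually_nhds_iff] at hO
  obtain ⟨δ, hδ, hO⟩ := hO
  simp only [hf0, sub_zero, dist_zero_right] at hO
  have hexp : ∀ t : Fin r → ℝ, ∏ j, Real.exp (-(c * t j)) = Real.exp (-(c * ∑ j, t j)) := by
    intro t
    rw [← Real.exp_sum, Finset.mul_sum, Finset.sum_neg_distrib]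
  have hglob : ∀ t : Fin r → ℝ, (∀ j, 0 ≤ t j) →
      ‖f t‖ ≤ (C + ‖multiKernel ξ γ a 0‖) * ∏ j, Real.exp (-(c * t j)) := by
    intro t ht
    refine (norm_sub_le _ _).trans ?_
    rw [add_mul, norm_mul, norm_prod]
    have h1 : ∏ j, Real.exp (-((γ j).re * t j)) ≤ ∏ j, Real.exp (-(c * t j)) := by
      refine Finset.prod_le_prod (fun _ _ => (Real.exp_pos _).le) fun j _ => ?_
      have h2 : c ≤ (γ j).re := (min_le_left _ _).trans (hcγ j).le
      have := ht j
      gcongr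
    have h3 : ∏ j, ‖Complex.exp (-(t j : ℂ))‖ ≤ ∏ j, Real.exp (-(c * t j)) := by
      refine Finset.prod_le_prod (fun _ _ => norm_nonneg _) fun j _ => ?_
      rw [Complex.norm_exp]
      have h2 : c * t j ≤ t j := mul_le_of_le_one_left (ht j) (min_le_right _ _)
      simpa using h2
    gcongr
    exact (hb t ht).trans (by gcongr)
  -- The first summand serves ‖t‖ < δ, where ∑ t_j ≤ rδ keeps the exponential factor bounded below;
  -- the second serves ‖t‖ ≥ δ, where ∑ t_j / δ ≥ 1.
  refine ⟨c, C₂ * Real.exp (c * (r * δ)) + (C + ‖multiKernel ξ γ a 0‖) / δ, hc0, by positivity,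
    fun t ht => ?_⟩
  have hsum0 : 0 ≤ ∑ j, t j := Finset.sum_nonneg fun j _ => ht j
  have hnt : ‖t‖ ≤ ∑ j, t j := by
    refine (pi_norm_le_iff_of_nonneg hsum0).2 fun j => ?_
    rw [Real.norm_of_nonneg (ht j)]
    exact Finset.single_le_sum (fun i _ => ht i) (Finset.mem_univ j)
  have hP : 0 < ∏ j, Real.exp (-(c * t j)) := Finset.prod_pos fun j _ => Real.exp_pos _
  rw [add_mul]
  rcases lt_or_ge ‖t‖ δ with h | h
  · have h1 : ‖f t‖ ≤ C₂ * ∑ j, t j := (hO h).trans (by gcongr)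
    have h2 : ∑ j, t j ≤ r * δ := by
      have : ∀ j ∈ (Finset.univ : Finset (Fin r)), t j ≤ δ := fun j _ =>
        ((le_abs_self _).trans (norm_le_pi_norm t j)).trans h.le
      simpa using Finset.sum_le_sum this
    have h3 : 1 ≤ Real.exp (c * (r * δ)) * ∏ j, Real.exp (-(c * t j)) := by
      rw [hexp, ← Real.exp_add]
      refine Real.one_le_exp ?_
      have := mul_le_mul_of_nonneg_left h2 hc0.le
      linarith
    have h4 : 0 ≤ (C + ‖multiKernel ξ γ a 0‖) / δ * ((∑ j, t j) * ∏ j, Real.exp (-(c * t j))) := by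
      positivity
    calc ‖f t‖ ≤ C₂ * (∑ j, t j) * 1 := by rw [mul_one]; exact h1
      _ ≤ C₂ * (∑ j, t j) * (Real.exp (c * (r * δ)) * ∏ j, Real.exp (-(c * t j))) := by gcongr
      _ ≤ _ := by linarith
  · have h1 : 1 ≤ (∑ j, t j) / δ := (one_le_div hδ).2 (h.trans hnt)
    have h4 : 0 ≤ C₂ * Real.exp (c * (r * δ)) * ((∑ j, t j) * ∏ j, Real.exp (-(c * t j))) := by
      positivity
    calc ‖f t‖ ≤ 1 * ((C + ‖multiKernel ξ γ a 0‖) * ∏ j, Real.exp (-(c * t j))) := by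
          rw [one_mul]; exact hglob t ht
      _ ≤ (∑ j, t j) / δ * ((C + ‖multiKernel ξ γ a 0‖) * ∏ j, Real.exp (-(c * t j))) := by gcongr
      _ = (C + ‖multiKernel ξ γ a 0‖) / δ * ((∑ j, t j) * ∏ j, Real.exp (-(c * t j))) := by ring
      _ ≤ _ := by linarith

theorem mul_prod_rpow_eq {r : ℕ} {t : Fin r → ℝ} (ht : ∀ j, 0 < t j) (ε c : ℝ) (i : Fin r) :
    t i * ∏ j, (t j ^ (ε - 1) * Real.exp (-(c * t j))) =
      ∏ j, (t j ^ (((fun _ => ε) + Pi.single i 1 : Fin r → ℝ) j - 1) * Real.exp (-(c * t j))) := by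
  rw [Fintype.prod_eq_mul_prod_compl i, Fintype.prod_eq_mul_prod_compl i, ← mul_assoc]
  congr 1
  · simp only [Pi.add_apply, Pi.single_eq_same]
    rw [show ε + 1 - 1 = (ε - 1) + 1 by ring, Real.rpow_add_one (ht i).ne']
    ring
  · refine Finset.prod_congr rfl fun j hj => ?_
    have : j ≠ i := by simpa using hj
    simp [this]

/-- The extra t_i produces Γ(ε + 1) = ε Γ(ε). The factor ε survives division by Γ(ε)^r and makes the
error vanish in the limit. -/
theorem integral_mul_prod_rpow {r : ℕ} {ε c : ℝ} (hε : 0 < ε) (hc : 0 < c) (i : Fin r) :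
    Integrable (fun t : Fin r → ℝ => t i * ∏ j, (t j ^ (ε - 1) * Real.exp (-(c * t j))))
      (orthantMeasure r) ∧
    ∫ t : Fin r → ℝ, t i * ∏ j, (t j ^ (ε - 1) * Real.exp (-(c * t j))) ∂orthantMeasure r =
      ε / c * ((1 / c) ^ ε * Real.Gamma ε) ^ r := by
  have hσ : ∀ j, 0 < ((fun _ => ε) + Pi.single i 1 : Fin r → ℝ) j := by
    intro j
    by_cases h : j = i
    · subst h
      simp
      linarith
    · simpa [h] using hε
  have hae : (fun t : Fin r → ℝ => t i * ∏ j, (t j ^ (ε - 1) * Real.exp (-(c * t j))))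
      =ᵐ[orthantMeasure r] fun t => ∏ j, (t j ^ (((fun _ => ε) + Pi.single i 1 : Fin r → ℝ) j - 1) *
        Real.exp (-(c * t j))) := by
    filter_upwards [ae_orthantMeasure_pos r] with t ht
    exact mul_prod_rpow_eq ht ε c i
  constructor
  · exact (integrable_prod_rpow_mul_exp (c := fun _ => c) hσ fun _ => hc).congr hae.symm
  · rw [integral_congr_ae hae, integral_prod_rpow_mul_exp (c := fun _ => c) hσ fun _ => hc]
    have h1 : ((1 / c) ^ ε * Real.Gamma ε) ^ r = ∏ _j : Fin r, ((1 / c) ^ ε * Real.Gamma ε) := by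
      simp
    rw [h1, Fintype.prod_eq_mul_prod_compl i, Fintype.prod_eq_mul_prod_compl i, ← mul_assoc]
    congr 1
    · simp only [Pi.add_apply, Pi.single_eq_same]
      rw [Real.Gamma_add_one hε.ne', Real.rpow_add_one (by positivity)]
      ring
    · refine Finset.prod_congr rfl fun j hj => ?_
      have : j ≠ i := by simpa using hj
      simp [this]

/-- The normalized Mellin transform tends to the value of the kernel at the origin. -/
theorem tendsto_normalizedMellin {r : ℕ} {ξ γ : Fin r → ℂ} (hξ : ∀ j, ‖ξ j‖ = 1)
    (hξ1 : ∀ j, ξ j ≠ 1) (hγ : ∀ j, 0 < (γ j).re) (a : Fin r → ℕ) :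
    Tendsto (fun ε : ℝ => normalizedMellin ξ γ a fun _ => (ε : ℂ)) (𝓝[>] 0)
      (𝓝 (∏ j, (ξ j / (1 - ξ j)) ^ (a j + 1))) := by
  obtain ⟨c, K, hc, hK, hb⟩ := exists_norm_multiKernel_sub_le hξ hξ1 hγ a
  rw [← multiKernel_zero ξ γ a]
  set g₀ := multiKernel ξ γ a 0 with hg₀
  have hlim : Tendsto (fun ε : ℝ => K * (r * (ε / c * ((1 / c) ^ ε) ^ r))) (𝓝[>] 0) (𝓝 0) := by
    have hcont : Continuous fun ε : ℝ => K * (r * (ε / c * ((1 / c) ^ ε) ^ r)) := by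
      have : Continuous fun ε : ℝ => (1 / c) ^ ε :=
        Real.continuous_const_rpow (by positivity)
      fun_prop
    exact (hcont.tendsto' 0 0 (by simp)).mono_left nhdsWithin_le_nhds
  rw [tendsto_iff_norm_sub_tendsto_zero]
  refine squeeze_zero' (Eventually.of_forall fun _ => norm_nonneg _) ?_ hlim
  filter_upwards [self_mem_nhdsWithin] with ε hε
  have hε : 0 < ε := hε
  have hs : ∀ _j : Fin r, 0 < ((fun _ => (ε : ℂ)) _j : ℂ).re := fun _ => by simpa using hε
  have hG : 0 < Real.Gamma ε := Real.Gamma_pos_of_pos hε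
  have hGne : Complex.Gamma (ε : ℂ) ≠ 0 := Complex.Gamma_ne_zero_of_re_pos (by simpa using hε)
  have hi1 := integrable_mellin hξ hξ1 hγ a (s := fun _ => (ε : ℂ)) hs
  have hi2 := (integrable_prod_cpow_mul_cexp (s := fun _ : Fin r => (ε : ℂ)) (z := fun _ => 1) hs
    (by simp)).const_mul g₀
  have hv := integral_prod_cpow_mul_cexp (s := fun _ : Fin r => (ε : ℂ)) (z := fun _ => 1) hs
    (by simp)
  -- The comparison exponential has Mellin transform exactly Γ(ε)^r, so it accounts for the whole
  -- limit g₀.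
  have hdiff : normalizedMellin ξ γ a (fun _ => (ε : ℂ)) - g₀ = (Complex.Gamma ε)⁻¹ ^ r *
      ∫ t : Fin r → ℝ, (∏ j, (t j : ℂ) ^ ((ε : ℂ) - 1)) *
        (multiKernel ξ γ a t - g₀ * ∏ j, Complex.exp (-(t j : ℂ))) ∂orthantMeasure r := by
    have h1 : (fun t : Fin r → ℝ => (∏ j, (t j : ℂ) ^ ((ε : ℂ) - 1)) *
        (multiKernel ξ γ a t - g₀ * ∏ j, Complex.exp (-(t j : ℂ)))) = fun t =>
        (∏ j, (t j : ℂ) ^ ((ε : ℂ) - 1)) * multiKernel ξ γ a t -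
          g₀ * ∏ j, ((t j : ℂ) ^ ((ε : ℂ) - 1) * Complex.exp (-(1 * (t j : ℂ)))) := by
      funext t
      simp only [one_mul, Finset.prod_mul_distrib]
      ring
    rw [h1, integral_sub hi1 hi2, integral_const_mul, hv]
    simp only [Complex.one_cpow, one_mul, Finset.prod_const, Finset.card_univ, Fintype.card_fin,
      normalizedMellin, mellinIntegral, mul_sub]
    rw [mul_left_comm, ← mul_pow, inv_mul_cancel₀ hGne, one_pow, mul_one]
  rw [hdiff, norm_mul, norm_pow, norm_inv, Complex.Gamma_ofReal, Complex.norm_real,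
    Real.norm_of_nonneg hG.le]
  have hInt : ‖∫ t : Fin r → ℝ, (∏ j, (t j : ℂ) ^ ((ε : ℂ) - 1)) *
        (multiKernel ξ γ a t - g₀ * ∏ j, Complex.exp (-(t j : ℂ))) ∂orthantMeasure r‖ ≤
      ∫ t : Fin r → ℝ, K * ∑ i, t i * ∏ j, (t j ^ (ε - 1) * Real.exp (-(c * t j)))
        ∂orthantMeasure r := by
    refine norm_integral_le_of_norm_le ((integrable_finsetSum _ fun i _ =>
      (integral_mul_prod_rpow hε hc i).1).const_mul K) ?_
    filter_upwards [ae_orthantMeasure_pos r] with t ht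
    rw [norm_mul, norm_prod_cpow (s := fun _ => (ε : ℂ)) ht, ← Finset.sum_mul,
      Finset.prod_mul_distrib, Complex.ofReal_re]
    have hP : 0 ≤ ∏ j, t j ^ (ε - 1) :=
      Finset.prod_nonneg fun j _ => Real.rpow_nonneg (ht j).le _
    calc _ ≤ (∏ j, t j ^ (ε - 1)) * (K * ((∑ j, t j) * ∏ j, Real.exp (-(c * t j)))) := by
          gcongr
          exact hb t fun j => (ht j).le
      _ = _ := by ring
  rw [integral_const_mul, integral_finsetSum _ fun i _ => (integral_mul_prod_rpow hε hc i).1,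
    Finset.sum_congr rfl fun i _ => (integral_mul_prod_rpow hε hc i).2] at hInt
  calc _ ≤ (Real.Gamma ε)⁻¹ ^ r * _ := mul_le_mul_of_nonneg_left hInt (by positivity)
    _ = K * (r * (ε / c * ((1 / c) ^ ε) ^ r)) := by
      simp only [Finset.sum_const, Finset.card_univ, Fintype.card_fin, nsmul_eq_mul, mul_pow]
      rw [inv_pow]
      field_simp

/-- The origin lies on the boundary of Re s_j > 0; continuity along the diagonal reaches it. -/
theorem entire_value_zero {r : ℕ} {ξ γ : Fin r → ℂ} (hξ : ∀ j, ‖ξ j‖ = 1)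
    (hξ1 : ∀ j, ξ j ≠ 1) (hγ : ∀ j, 0 < (γ j).re) {a : Fin r → ℕ} {Z : (Fin r → ℂ) → ℂ}
    (hZ : Differentiable ℂ Z) (hZE : EqOn Z (normalizedMellin ξ γ a) (shiftedOrthant 0)) :
    Z 0 = ∏ j, (ξ j / (1 - ξ j)) ^ (a j + 1) := by
  have h1 : Tendsto (fun ε : ℝ => Z fun _ => (ε : ℂ)) (𝓝[>] 0) (𝓝 (Z 0)) := by
    have hc : Continuous fun ε : ℝ => Z fun _ => (ε : ℂ) := hZ.continuous.comp (by fun_prop)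
    exact (hc.tendsto' 0 (Z 0) (by congr 1)).mono_left nhdsWithin_le_nhds
  refine tendsto_nhds_unique h1 ((tendsto_normalizedMellin hξ hξ1 hγ a).congr' ?_)
  filter_upwards [self_mem_nhdsWithin] with ε hε
  exact (hZE fun j => by simpa using hε).symm

/-! ### The recurrence for Maclaurin coefficients. -/

/-- Chain rule for substitution of a series with constant partial derivative. -/
theorem pderiv_subst_of_pderiv_eq_C {σ : Type*} (f : PowerSeries ℂ) {g : MvPowerSeries σ ℂ}
    (hg : PowerSeries.HasSubst g) {i : σ} {c : ℂ}
    (hc : MvPowerSeries.pderiv ℂ i g = MvPowerSeries.C c) :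
    MvPowerSeries.pderiv ℂ i (f.subst g) =
      MvPowerSeries.C c * (PowerSeries.derivative ℂ f).subst g := by
  ext n
  rw [MvPowerSeries.coeff_pderiv, MvPowerSeries.coeff_C_mul, PowerSeries.coeff_subst hg,
    PowerSeries.coeff_subst hg]
  have hfin1 := PowerSeries.coeff_subst_finite hg f (n + Finsupp.single i 1)
  have hfin2 := PowerSeries.coeff_subst_finite hg (PowerSeries.derivative ℂ f) n
  obtain ⟨M₁, hM₁⟩ := hfin1.bddAbove
  obtain ⟨M₂, hM₂⟩ := hfin2.bddAbove
  -- M exceeds both supports. The ranges M + 1 and M differ because differentiation lowers the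
  -- degree by one and kills the d = 0 term.
  set M := max M₁ M₂ + 1
  rw [finsum_eq_sum_of_support_subset (s := Finset.range (M + 1)) _ fun d hd => by
      have := hM₁ hd
      simp [M]
      omega,
    finsum_eq_sum_of_support_subset (s := Finset.range M) _ fun d hd => by
      have := hM₂ hd
      simp [M]
      omega]
  rw [Finset.sum_mul, Finset.sum_range_succ', Finset.mul_sum]
  have h0 : MvPowerSeries.coeff (n + Finsupp.single i 1) (g ^ 0) * ((n i : ℂ) + 1) = 0 := by
    rw [← MvPowerSeries.coeff_pderiv, pow_zero, MvPowerSeries.pderiv_one, map_zero]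
  rw [smul_mul_assoc, h0, smul_zero, add_zero]
  refine Finset.sum_congr rfl fun d _ => ?_
  rw [smul_mul_assoc, ← MvPowerSeries.coeff_pderiv, MvPowerSeries.pderiv_pow, hc,
    PowerSeries.coeff_derivative, Nat.add_sub_cancel, mul_comm _ (MvPowerSeries.C c),
    MvPowerSeries.coeff_C_mul, ← map_natCast (MvPowerSeries.C (σ := σ) (R := ℂ)),
    MvPowerSeries.coeff_C_mul, smul_eq_mul, smul_eq_mul]
  push_cast
  ring

/-- The linear form `γ_j (X_j + ⋯ + X_r)`. -/
def tailForm {r : ℕ} (γ : Fin r → ℂ) (j : Fin r) : MvPowerSeries (Fin r) ℂ :=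
  MvPowerSeries.C (γ j) * ∑ k ∈ Finset.Ici j, MvPowerSeries.X k

theorem constantCoeff_tailForm {r : ℕ} (γ : Fin r → ℂ) (j : Fin r) :
    MvPowerSeries.constantCoeff (tailForm γ j) = 0 := by
  simp [tailForm]

theorem hasSubst_tailForm {r : ℕ} (γ : Fin r → ℂ) (j : Fin r) :
    PowerSeries.HasSubst (tailForm γ j) :=
  PowerSeries.HasSubst.of_constantCoeff_zero (constantCoeff_tailForm γ j)

theorem pderiv_tailForm {r : ℕ} (γ : Fin r → ℂ) (i j : Fin r) :
    MvPowerSeries.pderiv ℂ i (tailForm γ j) = MvPowerSeries.C (if j ≤ i then γ j else 0) := by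
  rw [tailForm, Derivation.leibniz, MvPowerSeries.pderiv_C, smul_zero, add_zero, map_sum,
    smul_eq_mul]
  simp_rw [MvPowerSeries.pderiv_X, Pi.single_apply]
  rw [Finset.sum_ite_eq']
  simp only [Finset.mem_Ici]
  split_ifs <;> simp

/-- With G = 1/(1 - E) and E = η e^t, G' = G² E and G E = G - 1, so G' = G² - G; the sign change
gives a form matching the recurrence in s. -/
theorem derivative_neg_twistedGen {η : ℂ} (hη : η ≠ 1) :
    PowerSeries.derivative ℂ (-twistedGen η) =
      -(-twistedGen η + (-twistedGen η) ^ 2) := by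
  have hne : PowerSeries.constantCoeff (1 - PowerSeries.C η * PowerSeries.exp ℂ) ≠ 0 := by
    simpa [sub_eq_zero] using hη.symm
  have h1 : twistedGen η * (1 - PowerSeries.C η * PowerSeries.exp ℂ) = 1 :=
    PowerSeries.inv_mul_cancel _ hne
  have h2 : PowerSeries.derivative ℂ (twistedGen η) =
      twistedGen η ^ 2 * (PowerSeries.C η * PowerSeries.exp ℂ) := by
    rw [twistedGen, PowerSeries.derivative_inv', map_sub, Derivation.leibniz,
      PowerSeries.derivative_exp, PowerSeries.derivative_C, PowerSeries.derivative_one]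
    simp
  rw [map_neg, h2]
  linear_combination twistedGen η * h1

/-- The expansion of `h(γ_j (t_j + ⋯ + t_r))` with `h(t) = 1 / (ξ⁻¹ e^t - 1)`. -/
def kernelSeries {r : ℕ} (ξ γ : Fin r → ℂ) (j : Fin r) : MvPowerSeries (Fin r) ℂ :=
  (-twistedGen (ξ j)⁻¹).subst (tailForm γ j)

theorem pderiv_kernelSeries {r : ℕ} {ξ : Fin r → ℂ} (hξ1 : ∀ j, ξ j ≠ 1) (γ : Fin r → ℂ)
    (i j : Fin r) :
    MvPowerSeries.pderiv ℂ i (kernelSeries ξ γ j) =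
      -(MvPowerSeries.C (if j ≤ i then γ j else 0) *
        (kernelSeries ξ γ j + kernelSeries ξ γ j ^ 2)) := by
  have hη : (ξ j)⁻¹ ≠ 1 := by simpa using hξ1 j
  have hs := hasSubst_tailForm γ j
  rw [kernelSeries, pderiv_subst_of_pderiv_eq_C _ hs (pderiv_tailForm γ i j),
    derivative_neg_twistedGen hη, ← PowerSeries.coe_substAlgHom hs, map_neg, map_add, map_pow,
    mul_neg]

theorem constantCoeff_kernelSeries {r : ℕ} {ξ : Fin r → ℂ} (hξ0 : ∀ j, ξ j ≠ 0) (γ : Fin r → ℂ)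
    (j : Fin r) :
    MvPowerSeries.constantCoeff (kernelSeries ξ γ j) = ξ j / (1 - ξ j) := by
  rw [kernelSeries, PowerSeries.constantCoeff_subst (hasSubst_tailForm γ j),
    finsum_eq_single _ 0 fun d hd => by
      rw [map_pow, constantCoeff_tailForm, zero_pow hd, smul_zero]]
  have h0 := hξ0 j
  simp only [pow_zero, map_one, smul_eq_mul, mul_one, map_neg,
    PowerSeries.coeff_zero_eq_constantCoeff, twistedGen, PowerSeries.constantCoeff_inv, map_sub,
    map_mul, PowerSeries.constantCoeff_C, PowerSeries.constantCoeff_exp]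
  rcases eq_or_ne (ξ j) 1 with h | h
  -- Both sides are 0 by the convention 0⁻¹ = 0.
  · simp [h]
  · have h1 : 1 - ξ j ≠ 0 := sub_ne_zero.2 h.symm
    have h2 : 1 - (ξ j)⁻¹ ≠ 0 := sub_ne_zero.2 fun h' => h (by simpa using h'.symm)
    rw [neg_eq_iff_eq_neg, inv_eq_one_div, div_eq_iff h2]
    field_simp
    ring

/-- The expansion of `∏_j h_j(γ_j (t_j + ⋯ + t_r)) ^ (a_j + 1)`. -/
def multiKernelSeries {r : ℕ} (ξ γ : Fin r → ℂ) (a : Fin r → ℕ) : MvPowerSeries (Fin r) ℂ :=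
  ∏ j, kernelSeries ξ γ j ^ (a j + 1)

theorem derivation_prod {ι R A : Type*} [CommSemiring R] [CommRing A] [Algebra R A]
    [DecidableEq ι] (D : Derivation R A A) (s : Finset ι) (f : ι → A) :
    D (∏ i ∈ s, f i) = ∑ i ∈ s, (∏ j ∈ s.erase i, f j) * D (f i) := by
  induction s using Finset.induction_on with
  | empty => simp
  | insert i s hi ih =>
    rw [Finset.prod_insert hi, Derivation.leibniz, Finset.sum_insert hi, ih,
      Finset.erase_insert hi, smul_eq_mul, smul_eq_mul, Finset.mul_sum, add_comm]
    congr 1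
    refine Finset.sum_congr rfl fun k hk => ?_
    have hik : i ≠ k := fun h => hi (h ▸ hk)
    rw [Finset.erase_insert_of_ne hik, Finset.prod_insert (fun h => hi (Finset.mem_of_mem_erase h)),
      mul_assoc]

theorem multiKernelSeries_add_single {r : ℕ} (ξ γ : Fin r → ℂ) (a : Fin r → ℕ) (k : Fin r) :
    multiKernelSeries ξ γ (a + Pi.single k 1) = kernelSeries ξ γ k * multiKernelSeries ξ γ a := by
  rw [multiKernelSeries, multiKernelSeries, Fintype.prod_eq_mul_prod_compl k,
    Fintype.prod_eq_mul_prod_compl k (fun j => kernelSeries ξ γ j ^ (a j + 1)), ← mul_assoc]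
  congr 1
  · rw [Pi.add_apply, Pi.single_eq_same, pow_succ']
  · refine Finset.prod_congr rfl fun i hi => ?_
    have : i ≠ k := by simpa using hi
    simp [this]

/-- The variable t_i occurs in factor k exactly when k ≤ i, and H' = -(H + H²) turns the derivative
of H^(a+1) into -(a+1)(H^(a+1) + H^(a+2)). This mirrors `entire_recurrence` up to sign. -/
theorem pderiv_multiKernelSeries {r : ℕ} {ξ : Fin r → ℂ} (hξ1 : ∀ j, ξ j ≠ 1) (γ : Fin r → ℂ)
    (a : Fin r → ℕ) (i : Fin r) :
    MvPowerSeries.pderiv ℂ i (multiKernelSeries ξ γ a) =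
      -∑ k ∈ Finset.Iic i, MvPowerSeries.C (γ k * (a k + 1)) *
        (multiKernelSeries ξ γ a + multiKernelSeries ξ γ (a + Pi.single k 1)) := by
  rw [multiKernelSeries, derivation_prod, ← Finset.sum_neg_distrib]
  have hIic : Finset.Iic i = Finset.univ.filter (· ≤ i) := by ext; simp
  rw [hIic, Finset.sum_filter]
  refine Finset.sum_congr rfl fun k _ => ?_
  rw [multiKernelSeries_add_single, MvPowerSeries.pderiv_pow, pderiv_kernelSeries hξ1,
    Nat.add_sub_cancel, multiKernelSeries, ← Finset.mul_prod_erase Finset.univ _ (Finset.mem_univ k)]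
  split_ifs
  · push_cast
    rw [map_mul, map_add, map_one, map_natCast]
    ring
  · simp

/-! ### Values at nonpositive integers. -/

/-- The values of the continuations at nonpositive integers are Maclaurin coefficients. -/
theorem entire_value_neg_nat {r : ℕ} {ξ γ : Fin r → ℂ} (hξ : ∀ j, ‖ξ j‖ = 1)
    (hξ1 : ∀ j, ξ j ≠ 1) (hγ : ∀ j, 0 < (γ j).re) {Z : (Fin r → ℕ) → (Fin r → ℂ) → ℂ}
    (hZ : ∀ a, Differentiable ℂ (Z a))
    (hZE : ∀ a, EqOn (Z a) (normalizedMellin ξ γ a) (shiftedOrthant 0)) (n : Fin r → ℕ) :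
    ∀ a, Z a (fun j => -(n j : ℂ)) = (-1) ^ (∑ j, n j) * ((∏ j, ((n j).factorial : ℂ)) *
      MvPowerSeries.coeff (Finsupp.equivFunOnFinite.symm n) (multiKernelSeries ξ γ a)) := by
  have hξ0 : ∀ j, ξ j ≠ 0 := fun j h => by simpa [h] using hξ j
  induction hN : ∑ i, n i generalizing n with
  | zero =>
    intro a
    obtain rfl : n = 0 := by
      funext i
      exact (Finset.sum_eq_zero_iff.1 hN) i (Finset.mem_univ i)
    have h1 : (fun j : Fin r => -(((0 : Fin r → ℕ) j : ℕ) : ℂ)) = 0 := by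
      funext j
      simp
    have h2 : Finsupp.equivFunOnFinite.symm (0 : Fin r → ℕ) = 0 := by
      ext
      simp
    rw [h1, h2, entire_value_zero hξ hξ1 hγ (hZ a) (hZE a), MvPowerSeries.coeff_zero_eq_constantCoeff,
      multiKernelSeries, map_prod]
    simp [constantCoeff_kernelSeries hξ0]
  | succ N ih =>
    obtain ⟨j, -, hj⟩ : ∃ j ∈ Finset.univ, n j ≠ 0 := by
      by_contra! h
      rw [Finset.sum_eq_zero h] at hN
      omega
    obtain ⟨p, rfl⟩ : ∃ p : Fin r → ℕ, n = p + Pi.single j 1 := by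
      refine ⟨n - Pi.single j 1, ?_⟩
      funext i
      by_cases h : i = j
      · subst h
        simp
        omega
      · simp [h]
    have hN' : ∑ i, p i = N := by
      simp only [Pi.add_apply, Finset.sum_add_distrib, Finset.sum_pi_single', Finset.mem_univ,
        if_true] at hN
      omega
    intro a
    have hshift : (fun i => -(((p + Pi.single j 1 : Fin r → ℕ) i : ℕ) : ℂ)) + Pi.single j 1 =
        fun i => -(p i : ℂ) := by
      funext i
      by_cases h : i = j
      · subst h
        simp
      · simp [h]
    have hidx : Finsupp.equivFunOnFinite.symm (p + Pi.single j 1) =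
        Finsupp.equivFunOnFinite.symm p + Finsupp.single j 1 := by
      ext i
      simp [Finsupp.single_apply, Pi.single_apply, eq_comm]
    have hfac : ∏ i, (((p + Pi.single j 1 : Fin r → ℕ) i).factorial : ℂ) =
        (p j + 1) * ∏ i, ((p i).factorial : ℂ) := by
      rw [Fintype.prod_eq_mul_prod_compl j, Fintype.prod_eq_mul_prod_compl j, ← mul_assoc]
      congr 1
      · simp [Nat.factorial_succ]
      · refine Finset.prod_congr rfl fun i hi => ?_
        have : i ≠ j := by simpa using hi
        simp [this]
    rw [entire_recurrence hξ hξ1 hγ hZ hZE a j, hshift, hidx, hfac]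
    simp_rw [ih p hN']
    -- Extracting a coefficient of the derivative yields the factor p_j + 1 that completes the
    -- factorial; the minus sign supplies one more power of -1.
    have hcoef := congrArg (MvPowerSeries.coeff (Finsupp.equivFunOnFinite.symm p))
      (pderiv_multiKernelSeries hξ1 γ a j)
    rw [MvPowerSeries.coeff_pderiv, map_neg, map_sum] at hcoef
    simp only [MvPowerSeries.coeff_C_mul, map_add, Finsupp.coe_equivFunOnFinite_symm] at hcoef
    calc _ = (-1) ^ N * (∏ i, ((p i).factorial : ℂ)) * ∑ k ∈ Finset.Iic j, γ k * (a k + 1) *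
          (MvPowerSeries.coeff (Finsupp.equivFunOnFinite.symm p) (multiKernelSeries ξ γ a) +
          MvPowerSeries.coeff (Finsupp.equivFunOnFinite.symm p)
            (multiKernelSeries ξ γ (a + Pi.single k 1))) := by
          rw [Finset.mul_sum]
          refine Finset.sum_congr rfl fun k _ => ?_
          ring
      _ = _ := by
          rw [pow_succ]
          linear_combination ((-1) ^ N * (∏ i, ((p i).factorial : ℂ))) * hcoef

theorem multiKernelSeries_zero {r : ℕ} (ξ γ : Fin r → ℂ) :
    multiKernelSeries ξ γ 0 = (-1) ^ r * twistedMultipleGen (fun j => (ξ j)⁻¹) γ := by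
  have h : ∀ j, kernelSeries ξ γ j ^ ((0 : Fin r → ℕ) j + 1) =
      -1 * (twistedGen (ξ j)⁻¹).subst (tailForm γ j) := by
    intro j
    rw [kernelSeries, ← PowerSeries.coe_substAlgHom (hasSubst_tailForm γ j), map_neg]
    simp
  rw [multiKernelSeries, Finset.prod_congr rfl fun j _ => h j, Finset.prod_mul_distrib]
  simp [twistedMultipleGen, tailForm]

/-! ### Absolute convergence in 𝒟_r. -/

/-- The partial sum `m_1 + ⋯ + m_j`. -/
def indexSum {r : ℕ} (m : Fin r → ℕ+) (j : Fin r) : ℝ :=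
  ∑ k ∈ Finset.Iic j, ((m k : ℕ) : ℝ)

theorem le_indexSum {r : ℕ} (m : Fin r → ℕ+) (j : Fin r) : ((m j : ℕ) : ℝ) ≤ indexSum m j :=
  Finset.single_le_sum (f := fun k => ((m k : ℕ) : ℝ)) (fun _ _ => Nat.cast_nonneg _)
    (Finset.mem_Iic.2 le_rfl)

theorem one_le_indexSum {r : ℕ} (m : Fin r → ℕ+) (j : Fin r) : 1 ≤ indexSum m j :=
  le_trans (by exact_mod_cast PNat.pos (m j)) (le_indexSum m j)

theorem indexSum_mono {r : ℕ} (m : Fin r → ℕ+) : Monotone (indexSum m) := fun _ _ hij =>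
  Finset.sum_le_sum_of_subset_of_nonneg (Finset.Iic_subset_Iic.2 hij)
    fun _ _ _ => Nat.cast_nonneg _

/-- The constant dominates every |γ_k| and 1/Re γ_k, so the complex partial sum and m_1 + ⋯ + m_j
are comparable in both directions; the argument contributes at most e^{π|w|}. -/
theorem exists_norm_partialSum_cpow_le {r : ℕ} {γ : Fin r → ℂ} (hγ : ∀ j, 0 < (γ j).re) :
    ∃ C : ℝ, 1 ≤ C ∧ ∀ (m : Fin r → ℕ+) (j : Fin r) (w : ℂ),
      ‖partialSum γ m j ^ (-w)‖ ≤
        C ^ ‖w‖ * Real.exp (Real.pi * ‖w‖) * indexSum m j ^ (-w.re) := by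
  set C : ℝ := 1 + ∑ k, (‖γ k‖ + ((γ k).re)⁻¹) with hCdef
  have hterm : ∀ k, 0 ≤ ‖γ k‖ + ((γ k).re)⁻¹ := fun k => by
    have := hγ k
    positivity
  have hC1 : 1 ≤ C := le_add_of_nonneg_right (Finset.sum_nonneg fun k _ => hterm k)
  have hC0 : 0 < C := by linarith
  have hk : ∀ k, ‖γ k‖ + ((γ k).re)⁻¹ ≤ C := fun k => by
    have := Finset.single_le_sum (fun k _ => hterm k) (Finset.mem_univ k)
    linarith
  refine ⟨C, hC1, fun m j w => ?_⟩
  have hM : 0 < indexSum m j := by linarith [one_le_indexSum m j]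
  have hz := partialSum_ne_zero hγ m j
  have hn : 0 < ‖partialSum γ m j‖ := norm_pos_iff.2 hz
  have hup : ‖partialSum γ m j‖ ≤ C * indexSum m j := by
    rw [partialSum, indexSum, Finset.mul_sum]
    refine (norm_sum_le _ _).trans (Finset.sum_le_sum fun k _ => ?_)
    rw [norm_mul, Complex.norm_natCast, mul_comm]
    have := inv_pos.2 (hγ k)
    gcongr
    linarith [hk k]
  have hlow : indexSum m j ≤ C * ‖partialSum γ m j‖ := by
    have h1 : indexSum m j ≤ C * (partialSum γ m j).re := by
      rw [partialSum, indexSum, Complex.re_sum, Finset.mul_sum]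
      refine Finset.sum_le_sum fun k _ => ?_
      have h2 : 1 ≤ C * (γ k).re := by
        rw [← inv_mul_cancel₀ (hγ k).ne']
        have := hγ k
        gcongr
        linarith [hk k, norm_nonneg (γ k)]
      simp only [Complex.mul_re, Complex.natCast_re, Complex.natCast_im, zero_mul, sub_zero]
      calc ((m k : ℕ) : ℝ) = (m k : ℕ) * 1 := (mul_one _).symm
        _ ≤ (m k : ℕ) * (C * (γ k).re) := by gcongr
        _ = _ := by ring
    exact h1.trans (mul_le_mul_of_nonneg_left (Complex.re_le_norm _) hC0.le)
  have hratio : (‖partialSum γ m j‖ / indexSum m j) ^ (-w.re) ≤ C ^ ‖w‖ := by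
    have hw := Complex.abs_re_le_norm w
    have hq : 0 < ‖partialSum γ m j‖ / indexSum m j := div_pos hn hM
    have hq1 : ‖partialSum γ m j‖ / indexSum m j ≤ C := (div_le_iff₀ hM).2 hup
    have hq2 : (‖partialSum γ m j‖ / indexSum m j)⁻¹ ≤ C := by
      rw [inv_div]
      exact (div_le_iff₀ hn).2 hlow
    rcases le_total 0 w.re with h | h
    · rw [Real.rpow_neg hq.le, ← Real.inv_rpow hq.le]
      refine (Real.rpow_le_rpow (by positivity) hq2 h).trans
        (Real.rpow_le_rpow_of_exponent_le hC1 ((le_abs_self _).trans hw))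
    · refine (Real.rpow_le_rpow hq.le hq1 (by linarith)).trans
        (Real.rpow_le_rpow_of_exponent_le hC1 ((neg_le_abs _).trans hw))
  have harg : (Real.exp (Complex.arg (partialSum γ m j) * (-w).im))⁻¹ ≤
      Real.exp (Real.pi * ‖w‖) := by
    rw [← Real.exp_neg, Real.exp_le_exp]
    refine (le_abs_self _).trans ?_
    rw [abs_neg, abs_mul, Complex.neg_im, abs_neg]
    exact mul_le_mul (Complex.abs_arg_le_pi _) (Complex.abs_im_le_norm _) (abs_nonneg _)
      Real.pi_pos.le
  have hsplit : ‖partialSum γ m j‖ ^ (-w.re) =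
      (‖partialSum γ m j‖ / indexSum m j) ^ (-w.re) * indexSum m j ^ (-w.re) := by
    rw [← Real.mul_rpow (by positivity) hM.le, div_mul_cancel₀ _ hM.ne']
  rw [Complex.norm_cpow_of_ne_zero hz, div_eq_mul_inv, Complex.neg_re, hsplit]
  have hMp := Real.rpow_nonneg hM.le (-w.re)
  have hCp := Real.rpow_nonneg hC0.le ‖w‖
  calc _ ≤ C ^ ‖w‖ * indexSum m j ^ (-w.re) * Real.exp (Real.pi * ‖w‖) := by gcongr
    _ = _ := by ring

/-- In the convergence region, tail sums allow comparison with `∏ m_j ^ (-(1 + ε))`. -/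
theorem prod_indexSum_rpow_le {r : ℕ} {ε : ℝ} (hε : 0 < ε) (σ : Fin r → ℝ)
    (hσ : ∀ j, ∑ _k ∈ Finset.Ici j, (1 + ε) ≤ ∑ k ∈ Finset.Ici j, σ k) (m : Fin r → ℕ+) :
    ∏ j, indexSum m j ^ (-σ j) ≤ ∏ j, ((m j : ℕ) : ℝ) ^ (-(1 + ε)) := by
  have hM : ∀ j, 0 < indexSum m j := fun j => by linarith [one_le_indexSum m j]
  -- The inequality between products is Abel summation after taking logarithms.
  have h := sum_mul_nonneg_of_tail_nonneg (fun j => σ j - (1 + ε)) (fun j => Real.log (indexSum m j))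
    (fun i j hij => Real.log_le_log (hM i) (indexSum_mono m hij))
    (fun j => Real.log_nonneg (one_le_indexSum m j))
    (fun j => by
      rw [Finset.sum_sub_distrib]
      linarith [hσ j])
  calc ∏ j, indexSum m j ^ (-σ j) ≤ ∏ j, indexSum m j ^ (-(1 + ε)) := by
        simp_rw [fun j (x : ℝ) => Real.rpow_def_of_pos (hM j) x]
        rw [← Real.exp_sum, ← Real.exp_sum, Real.exp_le_exp, ← sub_nonneg, ← Finset.sum_sub_distrib]
        refine h.trans_eq (Finset.sum_congr rfl fun j _ => ?_)
        ring
    _ ≤ _ := by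
        refine Finset.prod_le_prod (fun j _ => Real.rpow_nonneg (hM j).le _) fun j _ => ?_
        exact Real.rpow_le_rpow_of_nonpos (by exact_mod_cast (m j).pos) (le_indexSum m j)
          (by linarith)

/-- Locally uniform absolute convergence of the multiple series in the convergence region. -/
theorem exists_summable_bound {r : ℕ} {ξ γ : Fin r → ℂ} (hξ : ∀ j, ‖ξ j‖ = 1)
    (hγ : ∀ j, 0 < (γ j).re) {s : Fin r → ℂ} (hs : s ∈ convergenceRegion r) :
    ∃ ε > 0, ∃ u : (Fin r → ℕ+) → ℝ, Summable u ∧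
      ∀ w ∈ Metric.ball s ε, ∀ m, ‖zetaTerm ξ γ w m‖ ≤ u m := by
  obtain ⟨δ, hδ, hδs⟩ := Pi.exists_forall_pos_add_lt hs
  obtain ⟨C, hC, hb⟩ := exists_norm_partialSum_cpow_le hγ
  -- Each of at most r coordinates loses ε from moving w and ε from the exponent 1 + ε, so 2rε ≤ δ
  -- suffices.
  set ε : ℝ := δ / (2 * (r + 1)) with hεdef
  have hε : 0 < ε := by positivity
  have hεr : (r : ℝ) * (2 * ε) ≤ δ := by
    rw [hεdef]
    field_simp
    linarith
  set R : ℝ := ‖s‖ + ε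
  have hR : 0 ≤ R := by positivity
  set K : ℝ := C ^ R * Real.exp (Real.pi * R) with hK
  have hK0 : 0 ≤ K := by positivity
  refine ⟨ε, hε, fun m => K ^ r * ∏ j, ((m j : ℕ) : ℝ) ^ (-(1 + ε)), ?_, fun w hw m => ?_⟩
  · refine Summable.mul_left _ (summable_pi_prod_real (fun _ (i : ℕ+) => ((i : ℕ) : ℝ) ^ (-(1 + ε)))
      (fun _ => summable_pnat_rpow (by linarith)) fun _ i => by positivity)
  · have hws : ‖w - s‖ < ε := mem_ball_iff_norm.1 hw
    have hwR : ∀ j, ‖w j‖ ≤ R := fun j => by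
      refine (norm_le_pi_norm w j).trans ?_
      have := norm_sub_norm_le w s
      simp only [R]
      linarith
    have hwre : ∀ j, (s j).re - ε ≤ (w j).re := fun j => by
      have h1 := (Complex.abs_re_le_norm ((w - s) j)).trans (norm_le_pi_norm (w - s) j)
      rw [Pi.sub_apply, Complex.sub_re] at h1
      linarith [neg_abs_le ((w j).re - (s j).re)]
    have hM : ∀ j, 0 < indexSum m j := fun j => by linarith [one_le_indexSum m j]
    have hfac : ∀ j, ‖partialSum γ m j ^ (-w j)‖ ≤ K * indexSum m j ^ (-((s j).re - ε)) := by
      intro j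
      refine (hb m j (w j)).trans ?_
      have h1 : indexSum m j ^ (-(w j).re) ≤ indexSum m j ^ (-((s j).re - ε)) :=
        Real.rpow_le_rpow_of_exponent_le (one_le_indexSum m j) (by linarith [hwre j])
      have h2 : C ^ ‖w j‖ ≤ C ^ R := Real.rpow_le_rpow_of_exponent_le hC (hwR j)
      have h3 : Real.exp (Real.pi * ‖w j‖) ≤ Real.exp (Real.pi * R) := by
        have := hwR j
        have := Real.pi_pos
        gcongr
      have := Real.rpow_nonneg (hM j).le (-(w j).re)
      rw [hK]
      gcongr
    rw [zetaTerm_eq, norm_mul, norm_prod, norm_prod]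
    simp only [norm_pow, hξ, one_pow, Finset.prod_const_one, one_mul]
    refine (Finset.prod_le_prod (fun _ _ => norm_nonneg _) fun j _ => hfac j).trans ?_
    rw [Finset.prod_mul_distrib, Finset.prod_const, Finset.card_univ, Fintype.card_fin]
    refine mul_le_mul_of_nonneg_left (prod_indexSum_rpow_le hε _ (fun j => ?_) m) (by positivity)
    have hj := hδs j
    have hjr : (j : ℕ) ≤ r := j.2.le
    rw [Complex.re_sum] at hj
    rw [Finset.sum_sub_distrib, Finset.sum_const, Finset.sum_const, Fin.card_Ici, nsmul_eq_mul,
      nsmul_eq_mul, Nat.cast_sub hjr]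
    have : ((j : ℕ) : ℝ) * ε ≥ 0 := by positivity
    linarith

/-! ### Agreement with the series on 𝒟_r, and uniqueness. -/

theorem isOpen_convergenceRegion (r : ℕ) : IsOpen (convergenceRegion r) := by
  simp only [convergenceRegion, ofPred_forall]
  refine isOpen_iInter_of_finite fun j => isOpen_lt continuous_const ?_
  exact Complex.continuous_re.comp (continuous_finsetSum _ fun k _ => continuous_apply k)

theorem convex_convergenceRegion (r : ℕ) : Convex ℝ (convergenceRegion r) := by
  simp only [convergenceRegion, ofPred_forall]
  refine convex_iInter fun j => convex_halfSpace_gt ⟨fun x y => ?_, fun c x => ?_⟩ _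
  · simp [Finset.sum_add_distrib]
  · simp [Finset.mul_sum]

/-- Locally uniform majorants give holomorphy on each complex line, which is all that
`eqOn_of_holomorphic_on_lines` asks of the series. -/
theorem differentiableOn_zetaSeries_line {r : ℕ} {ξ γ : Fin r → ℂ} (hξ : ∀ j, ‖ξ j‖ = 1)
    (hγ : ∀ j, 0 < (γ j).re) (x y : Fin r → ℂ) :
    DifferentiableOn ℂ (fun z : ℂ => zetaSeries ξ γ (x + z • y))
      {z | x + z • y ∈ convergenceRegion r} := by
  intro z₀ hz₀
  refine DifferentiableAt.differentiableWithinAt ?_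
  obtain ⟨ε, hε, u, hu, hb⟩ := exists_summable_bound hξ hγ hz₀
  have hcont : Continuous fun z : ℂ => x + z • y := by fun_prop
  have ho : IsOpen ((fun z : ℂ => x + z • y) ⁻¹' Metric.ball (x + z₀ • y) ε) :=
    Metric.isOpen_ball.preimage hcont
  refine (Complex.differentiableOn_tsum_of_summable_norm hu (fun m => ?_) ho
    fun m w hw => hb _ hw m).differentiableAt (ho.mem_nhds (Metric.mem_ball_self hε))
  refine Differentiable.differentiableOn fun z => ?_
  simp only [zetaTerm_eq]
  refine DifferentiableAt.const_mul (differentiableAt_fintype_prod fun j => ?_) _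
  refine DifferentiableAt.const_cpow ?_ (Or.inl (partialSum_ne_zero hγ m j))
  simp only [Pi.add_apply, Pi.smul_apply]
  fun_prop

theorem const_three_mem_convergenceRegion (r : ℕ) : (fun _ => 3) ∈ convergenceRegion r := by
  intro j
  rw [Finset.sum_const, Fin.card_Ici, nsmul_eq_mul, Nat.cast_sub j.2.le]
  simp

theorem zetaSeries_eq_normalizedMellin {r : ℕ} {ξ γ : Fin r → ℂ} (hξ : ∀ j, ‖ξ j‖ = 1)
    (hγ : ∀ j, 0 < (γ j).re) {s : Fin r → ℂ} (hs : ∀ j, 1 < (s j).re) :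
    zetaSeries ξ γ s = normalizedMellin ξ γ 0 s := by
  have h := hasSum_weightedTerm hξ hγ 0 (s := s) fun j => by simpa using hs j
  rw [← h.tsum_eq, zetaSeries]
  refine tsum_congr fun m => ?_
  simp [weightedTerm, chooseWeight]

theorem isEntireContinuation_of_eqOn {r : ℕ} {ξ γ : Fin r → ℂ} (hξ : ∀ j, ‖ξ j‖ = 1)
    (hγ : ∀ j, 0 < (γ j).re) {Z : (Fin r → ℂ) → ℂ} (hZ : Differentiable ℂ Z)
    (hZE : EqOn Z (normalizedMellin ξ γ 0) (shiftedOrthant 0)) : IsEntireContinuation ξ γ Z := by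
  refine ⟨hZ, fun s hs => ?_⟩
  refine eqOn_of_holomorphic_on_lines (isOpen_convergenceRegion r) (convex_convergenceRegion r)
    (fun x y => (hZ.comp (g := Z) (f := fun z : ℂ => x + z • y) (by fun_prop)).differentiableOn)
    (differentiableOn_zetaSeries_line hξ hγ) (const_three_mem_convergenceRegion r) ?_ hs
  -- Near (3, …, 3) all real parts exceed 1, so the series is the Mellin transform with a = 0.
  have hmem : (fun _ => (3 : ℂ)) ∈ shiftedOrthant (fun _ : Fin r => (-1 : ℝ)) := fun j => by
    norm_num
  filter_upwards [(isOpen_shiftedOrthant _).mem_nhds hmem] with w hw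
  have hw' : ∀ j, 1 < (w j).re := fun j => by simpa using hw j
  rw [zetaSeries_eq_normalizedMellin hξ hγ hw']
  exact hZE fun j => by simpa using one_pos.trans (hw' j)

theorem IsEntireContinuation.unique {r : ℕ} {ξ γ : Fin r → ℂ} {F G : (Fin r → ℂ) → ℂ}
    (hF : IsEntireContinuation ξ γ F) (hG : IsEntireContinuation ξ γ G) : F = G := by
  have hnb := (isOpen_convergenceRegion r).mem_nhds (const_three_mem_convergenceRegion r)
  have h := eqOn_of_differentiableOn isOpen_univ convex_univ hF.1.differentiableOn
    hG.1.differentiableOn (mem_univ _)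
    (Filter.mem_of_superset hnb fun s hs => (hF.2 s hs).trans (hG.2 s hs).symm)
  exact funext fun s => h (mem_univ s)

end EulerZagierLerch

end

theorem mainTheorem1 {r : ℕ} (ξ γ : Fin r → ℂ)
    (hξ : ∀ j, IsOfFinOrder (ξ j)) (hξ1 : ∀ j, ξ j ≠ 1) (hγ : ∀ j, 0 < (γ j).re) :
    (∀ s ∈ EulerZagierLerch.convergenceRegion r,
      Summable fun m : Fin r → ℕ+ => ‖EulerZagierLerch.zetaTerm ξ γ s m‖) ∧
    (∃ F : (Fin r → ℂ) → ℂ, EulerZagierLerch.IsEntireContinuation ξ γ F) ∧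
    ∀ F : (Fin r → ℂ) → ℂ, EulerZagierLerch.IsEntireContinuation ξ γ F →
      ∀ n : Fin r → ℕ,
        F (fun j => -(n j : ℂ)) =
          (-1) ^ (r + ∑ j, n j) *
            EulerZagierLerch.twistedMultipleBernoulli n (fun j => (ξ j)⁻¹) γ := by
  have hξn : ∀ j, ‖ξ j‖ = 1 := fun j => (hξ j).norm_eq_one
  choose Z hZ hZE using EulerZagierLerch.exists_entire_continuation hξn hξ1 hγ
  have hZ0 := EulerZagierLerch.isEntireContinuation_of_eqOn hξn hγ (hZ 0) (hZE 0)
  refine ⟨fun s hs => ?_, ⟨Z 0, hZ0⟩, fun F hF n => ?_⟩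
  · obtain ⟨ε, hε, u, hu, hb⟩ := EulerZagierLerch.exists_summable_bound hξn hγ hs
    exact Summable.of_nonneg_of_le (fun _ => norm_nonneg _) (hb s (Metric.mem_ball_self hε)) hu
  · rw [hF.unique hZ0, EulerZagierLerch.entire_value_neg_nat hξn hξ1 hγ hZ hZE,
      EulerZagierLerch.multiKernelSeries_zero, EulerZagierLerch.twistedMultipleBernoulli]
    have hC : ((-1 : MvPowerSeries (Fin r) ℂ)) ^ r = MvPowerSeries.C ((-1) ^ r) := by simp
    rw [hC, MvPowerSeries.coeff_C_mul, pow_add]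
    ring
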